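/- **Theorem (Joyal–Tierney).** Let $\mathcal L$ be a countable first-order language and let $\mathcal T$ be a countable $\mathcal L_{\omega_1\omega}$ theory. (Structures may be empty.) A *$\Sigma_1$ formula* is one built from atomic formulas using $\wedge,\top,\exists$ and countable disjunctions $\bigvee$, with finitely many free variables. *$\mathcal T$ proves $\sigma$* means that the sentence $\sigma$ holds in every countable model of $\mathcal T$, which by the completeness theorem for $\mathcal L_{\omega_1\omega}$ is the same as provability from $\mathcal T$. An *étale space* over a topological space $X$ is a space $A$ with a local homeomorphism $A\to X$. An *étale $\mathcal L$-structure* $p:\mathcal M\to X$ consists of an étale space $p:M\to X$, a continuous map $f^{\mathcal M}:M^n_X\to M$ over $X$ for each $n$-ary function symbol $f$, and an open set $R^{\mathcal M}\subseteq M^n_X$ for each $n$-ary relation symbol $R$, where $M^n_X=\{(x,a_0,\dots,a_{n-1})\in X\times M^n : p(a_i)=x \text{ for all } i\}$. Each fiber $\mathcal M_x$ is then an $\mathcal L$-structure, and each formula $\phi$ in $n$ variables has an interpretation $\phi^{\mathcal M}\subseteq M^n_X$ with fibers $\phi^{\mathcal M_x}$. The *isomorphism groupoid* $\mathrm{Iso}_X(\mathcal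 M)$ is the set of triples $(x,y,g)$ with $g:\mathcal M_x\cong\mathcal M_y$ an isomorphism, with the topology generated by the two projections to $X$ and the sets $\{(x,y,g): g(U_x)\cap V_y\neq\emptyset\}$ for $U,V\subseteq M$ open. An *étale $\mathrm{Iso}_X(\mathcal M)$-space* is an étale space $A\to X$ with a jointly continuous action of $\mathrm{Iso}_X(\mathcal M)$, where $g:\mathcal M_x\cong\mathcal M_y$ acts as a bijection $A_x\cong A_y$; morphisms are the equivariant continuous maps over $X$. A *$\Sigma_1$ imaginary over $\mathcal T$* is an expression $\Phi=(\bigsqcup_i\phi_i)/(\bigsqcup_{i,j}\epsilon_{ij})$, where $i,j$ run over the same countable index set, $\phi_i$ is a $\Sigma_1$ formula in $n_i$ variables, $\epsilon_{ij}$ is a $\Sigma_1$ formula in $n_i+n_j$ variables, and $\mathcal T$ proves that $\bigsqcup_{i,j}\epsilon_{ij}$ is an equivalence relation on $\bigsqcup_i\phi_i$. For an étale model $\mathcal M\to X$ of $\mathcal T$ with $M$ second-countable, $\Phi^{\mathcal M}:=(\bigsqcup_i\phi_i^{\mathcal M})/(\bigsqcup_{i,j}\epsilon_{ij}^{\mathcal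 M})$ is an étale $\mathrm{Iso}_X(\mathcal M)$-space. The $\Sigma_1$ imaginaries over $\mathcal T$ form a category (the syntactic $\sigma$-pretopos of $\mathcal T$), whose morphisms $\Phi\to\Psi=(\bigsqcup_k\psi_k)/(\bigsqcup_{k,l}\eta_{kl})$ are the $\Sigma_1$-definable functions modulo $\mathcal T$-provable equivalence, i.e. the families $\Theta=(\theta_{ik})$ of $\Sigma_1$ formulas in $n_i+m_k$ variables (where $\psi_k$ has $m_k$ variables) which are $\mathcal T$-provably contained in $\bigsqcup_{i,k}\phi_i\wedge\psi_k$, invariant under $\epsilon$ and $\eta$, and the graph of a function $\Phi\to\Psi$. Let $p:\mathcal M\to X$ be an étale $\mathcal L$-structure with $M$ second-countable such that * $\mathcal M$ has $\Sigma_1$ saturations: for every $n\in\mathbb N$ and open $U\subseteq M^n_X$, the saturation $\mathrm{Iso}_X(\mathcal M)\cdot U$ equals $\phi^{\mathcal M}$ for some $\Sigma_1$ formula $\phi(x_0,\dots,x_{n-1})$; * $X$ parametrizes the models of $\mathcal T$ via $\mathcal M$: a countable $\mathcal L$-structure is a model of $\mathcal T$ if and only if it is isomorphic to $\mathcal M_x$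 for some $x\in X$. Then: 1. Every second-countable étale $\mathrm{Iso}_X(\mathcal M)$-space is isomorphic to $\Phi^{\mathcal M}$ for some $\Sigma_1$ imaginary $\Phi$ over $\mathcal T$. 2. If moreover $X$ is second-countable, then the functor $\Phi\mapsto\Phi^{\mathcal M}$, which sends a $\Sigma_1$-definable function $\Theta:\Phi\to\Psi$ to the map $\Theta^{\mathcal M}:\Phi^{\mathcal M}\to\Psi^{\mathcal M}$ with graph $\bigsqcup_{i,k}\theta_{ik}^{\mathcal M}$, is an equivalence from the category of $\Sigma_1$ imaginaries over $\mathcal T$ to the category of second-countable étale $\mathrm{Iso}_X(\mathcal M)$-spaces. -/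

import Mathlib

open FirstOrder CategoryTheory Topology

universe u v w w'

namespace EtaleModels

/-! ### Countably infinitary formulas -/

/-- Formulas of `L_{ω₁ω}` whose free variables are among `x₀, …, x_{n-1}`. As usual `⋀` and `∀` are
abbreviations for `¬⋁¬` and `¬∃¬`; `⊥` is the empty disjunction. The quantifier binds the last
variable. -/
inductive Formula (L : FirstOrder.Language.{u, v}) : ℕ → Type (max 1 u v)
  | equal {n : ℕ} (s t : L.Term (Fin n)) : Formula L n
  | rel {n k : ℕ} (R : L.Relations k) (ts : Fin k → L.Term (Fin n)) : Formula L n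
  | top {n : ℕ} : Formula L n
  | and {n : ℕ} (φ ψ : Formula L n) : Formula L n
  | not {n : ℕ} (φ : Formula L n) : Formula L n
  | ex {n : ℕ} (φ : Formula L (n + 1)) : Formula L n
  | sup {n : ℕ} {ι : Type} [Countable ι] (φ : ι → Formula L n) : Formula L n

namespace Formula

variable {L : FirstOrder.Language.{u, v}}

/-- Satisfaction `N ⊨ φ(v)`. -/
def Realize {N : Type w} [L.Structure N] : {n : ℕ} → Formula L n → (Fin n → N) → Prop
  | _, equal s t, x => s.realize x = t.realize x
  | _, rel R ts, x => FirstOrder.Language.Structure.RelMap R fun i => (ts i).realize x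
  | _, top, _ => True
  | _, and φ ψ, x => φ.Realize x ∧ ψ.Realize x
  | _, not φ, x => ¬ φ.Realize x
  | _, ex φ, x => ∃ a : N, φ.Realize (Fin.snoc (α := fun _ => N) x a)
  | _, sup φ, x => ∃ i, (φ i).Realize x

/-- The `Σ₁` formulas: those built from atomic formulas using `∧, ⊤, ∃, ⋁`. -/
def IsSigma1 : {n : ℕ} → Formula L n → Prop
  | _, equal _ _ => True
  | _, rel _ _ => True
  | _, top => True
  | _, and φ ψ => φ.IsSigma1 ∧ ψ.IsSigma1
  | _, not _ => False
  | _, ex φ => φ.IsSigma1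
  | _, sup φ => ∀ i, (φ i).IsSigma1

/-- `φ → ψ`. -/
def imp {n : ℕ} (φ ψ : Formula L n) : Formula L n := not (and φ (not ψ))

/-- `φ ↔ ψ`. -/
def iff {n : ℕ} (φ ψ : Formula L n) : Formula L n := and (imp φ ψ) (imp ψ φ)

/-- The universal closure `∀ x₀ … x_{n-1}, φ`. -/
def alls : {n : ℕ} → Formula L n → Formula L 0
  | 0, φ => φ
  | _ + 1, φ => alls (not (ex (not φ)))

/-- `∃ x_n … x_{n+k-1}, φ`. -/
def exs {n : ℕ} : (k : ℕ) → Formula L (n + k) → Formula L n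
  | 0, φ => φ
  | k + 1, φ => exs k (ex φ)

/-- Renaming of the free variables along `f`. -/
def relabel : {n m : ℕ} → (Fin n → Fin m) → Formula L n → Formula L m
  | _, _, f, equal s t => equal (s.relabel f) (t.relabel f)
  | _, _, f, rel R ts => rel R fun i => (ts i).relabel f
  | _, _, _, top => top
  | _, _, f, and φ ψ => and (φ.relabel f) (ψ.relabel f)
  | _, _, f, not φ => not (φ.relabel f)
  | _, m, f, ex φ =>
      ex (φ.relabel (Fin.snoc (α := fun _ => Fin (m + 1)) (fun i => (f i).castSucc) (Fin.last m)))
  | _, _, f, sup φ => sup fun i => (φ i).relabel f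

section Lemmas

variable {N : Type w} [L.Structure N]

theorem realize_imp {n : ℕ} (φ ψ : Formula L n) (x : Fin n → N) :
    (φ.imp ψ).Realize x ↔ (φ.Realize x → ψ.Realize x) := by
  simp [imp, Realize]

theorem realize_iff {n : ℕ} (φ ψ : Formula L n) (x : Fin n → N) :
    (φ.iff ψ).Realize x ↔ (φ.Realize x ↔ ψ.Realize x) := by
  simp only [iff, Realize, realize_imp]
  exact ⟨fun h => ⟨h.1, h.2⟩, fun h => ⟨h.1, h.2⟩⟩

theorem realize_alls {n : ℕ} (φ : Formula L n) (z : Fin 0 → N) :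
    (alls φ).Realize z ↔ ∀ x : Fin n → N, φ.Realize x := by
  induction n with
  | zero =>
    refine ⟨fun h x => ?_, fun h => h z⟩
    rwa [Subsingleton.elim x z]
  | succ n ih =>
    simp only [alls, ih, Realize, not_exists, not_not]
    refine ⟨fun h x => ?_, fun h x a => h _⟩
    have := h (Fin.init (α := fun _ => N) x) (x (Fin.last n))
    rwa [Fin.snoc_init_self] at this

theorem realize_exs {n : ℕ} (k : ℕ) (φ : Formula L (n + k)) (x : Fin n → N) :
    (exs k φ).Realize x ↔ ∃ y : Fin k → N, φ.Realize (Fin.append x y) := by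
  induction k with
  | zero =>
    have : ∀ y : Fin 0 → N, Fin.append x y = x := fun y => by
      rw [Subsingleton.elim y Fin.elim0, Fin.append_elim0]; rfl
    simp only [this]
    exact ⟨fun h => ⟨Fin.elim0, h⟩, fun ⟨_, h⟩ => h⟩
  | succ k ih =>
    simp only [exs, ih, Realize]
    constructor
    · rintro ⟨y, a, h⟩
      exact ⟨Fin.snoc (α := fun _ => N) y a, by rwa [Fin.append_snoc]⟩
    · rintro ⟨y, h⟩
      refine ⟨Fin.init (α := fun _ => N) y, y (Fin.last k), ?_⟩
      rwa [← Fin.append_snoc, Fin.snoc_init_self]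

theorem realize_relabel {n m : ℕ} (f : Fin n → Fin m) (φ : Formula L n) (x : Fin m → N) :
    (φ.relabel f).Realize x ↔ φ.Realize fun i => x (f i) := by
  induction φ generalizing m with
  | equal s t => simp [relabel, Realize, FirstOrder.Language.Term.realize_relabel, Function.comp_def]
  | rel R ts => simp [relabel, Realize, FirstOrder.Language.Term.realize_relabel, Function.comp_def]
  | top => simp [relabel, Realize]
  | and φ ψ h1 h2 => simp [relabel, Realize, h1, h2]
  | not φ h => simp [relabel, Realize, h]
  | sup φ h => simp [relabel, Realize, h]
  | ex φ h =>
    simp only [relabel, Realize, h]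
    refine exists_congr fun a => ?_
    apply Iff.of_eq
    congr 1
    funext i
    refine Fin.lastCases ?_ (fun i => ?_) i <;> simp

theorem IsSigma1.relabel {n m : ℕ} (f : Fin n → Fin m) {φ : Formula L n} (h : φ.IsSigma1) :
    (φ.relabel f).IsSigma1 := by
  induction φ generalizing m with
  | equal s t => trivial
  | rel R ts => trivial
  | top => trivial
  | and φ ψ h1 h2 => exact ⟨h1 f h.1, h2 f h.2⟩
  | not φ _ => exact h.elim
  | sup φ ih => exact fun i => ih i f (h i)
  | ex φ ih => exact ih _ h

theorem IsSigma1.exs {n : ℕ} (k : ℕ) {φ : Formula L (n + k)} (h : φ.IsSigma1) :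
    (exs k φ).IsSigma1 := by
  induction k with
  | zero => exact h
  | succ k ih => exact ih (φ := ex φ) h

theorem realize_equiv {P : Type w'} [L.Structure P] (e : N ≃[L] P) {n : ℕ} (φ : Formula L n)
    (x : Fin n → N) : φ.Realize (fun i => e (x i)) ↔ φ.Realize x := by
  have ht : ∀ {n : ℕ} (t : L.Term (Fin n)) (x : Fin n → N),
      t.realize (fun i => e (x i)) = e (t.realize x) := fun t x =>
    FirstOrder.Language.HomClass.realize_term e (t := t) (v := x)
  induction φ with
  | equal s t => simp [Realize, ht]
  | rel R ts =>
    simp only [Realize, ht]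
    exact FirstOrder.Language.StrongHomClass.map_rel e R fun i => (ts i).realize x
  | top => simp [Realize]
  | and φ ψ h1 h2 => simp [Realize, h1, h2]
  | not φ h => simp [Realize, h]
  | sup φ h => simp [Realize, h]
  | ex φ h =>
    simp only [Realize]
    have key : ∀ a : N, (Fin.snoc (α := fun _ => P) (fun i => e (x i)) (e a)) =
        fun i => e (Fin.snoc (α := fun _ => N) x a i) := fun a => by
      funext i
      refine Fin.lastCases ?_ (fun i => ?_) i <;> simp
    constructor
    · rintro ⟨b, hb⟩
      refine ⟨e.symm b, ?_⟩
      refine (h _).1 ?_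
      rw [← key]
      simpa using hb
    · rintro ⟨a, ha⟩
      refine ⟨e a, ?_⟩
      rw [key]
      exact (h _).2 ha

end Lemmas

end Formula

/-! ### Theories -/

section Theories

variable {L : FirstOrder.Language.{u, v}}

/-- `N` is a model of the theory `T`, a set of `L_{ω₁ω}` sentences. -/
def IsModel (T : Set (Formula L 0)) (N : Type w) [L.Structure N] : Prop :=
  ∀ σ ∈ T, σ.Realize (Fin.elim0 : Fin 0 → N)

/-- `T` proves the sentence `σ`: by the completeness theorem for `L_{ω₁ω}`, this means that `σ` holds
in every countable model of `T` (every countable structure is isomorphic to one in `Type`; structures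
may be empty). -/
def Proves (T : Set (Formula L 0)) (σ : Formula L 0) : Prop :=
  ∀ (N : Type) [L.Structure N] [Countable N], IsModel T N → σ.Realize (Fin.elim0 : Fin 0 → N)

theorem IsModel.of_equiv {T : Set (Formula L 0)} {N : Type w} [L.Structure N] {P : Type w'}
    [L.Structure P] (e : N ≃[L] P) (h : IsModel T N) : IsModel T P := fun σ hσ => by
  have := (Formula.realize_equiv e σ Fin.elim0).2 (h σ hσ)
  rwa [Subsingleton.elim (fun i => e (Fin.elim0 i)) (Fin.elim0 : Fin 0 → P)] at this

theorem Proves.realize {T : Set (Formula L 0)} {σ : Formula L 0} (h : Proves T σ) (N : Type w)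
    [L.Structure N] [Countable N] (hN : IsModel T N) : σ.Realize (Fin.elim0 : Fin 0 → N) := by
  have : Countable (Shrink.{0} N) := (equivShrink.{0} N).symm.injective.countable
  let : L.Structure (Shrink.{0} N) := (equivShrink.{0} N).inducedStructure
  let e : N ≃[L] Shrink.{0} N := (equivShrink.{0} N).inducedStructureEquiv
  have := h (Shrink.{0} N) (hN.of_equiv e)
  rw [Subsingleton.elim (Fin.elim0 : Fin 0 → Shrink.{0} N) (fun i => e (Fin.elim0 i))] at this
  exact (Formula.realize_equiv e σ _).1 this

theorem proves_alls {T : Set (Formula L 0)} {n : ℕ} {φ : Formula L n} :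
    Proves T φ.alls ↔ ∀ (N : Type) [L.Structure N] [Countable N], IsModel T N →
      ∀ x : Fin n → N, φ.Realize x := by
  simp only [Proves, Formula.realize_alls]

theorem Proves.realize_alls {T : Set (Formula L 0)} {n : ℕ} {φ : Formula L n}
    (h : Proves T φ.alls) (N : Type w) [L.Structure N] [Countable N] (hN : IsModel T N)
    (x : Fin n → N) : φ.Realize x :=
  (Formula.realize_alls φ _).1 (h.realize N hN) x

end Theories

/-! ### `Σ₁` imaginaries and `Σ₁`-definable functions -/

/-- A `Σ₁` imaginary sort `Φ = (⨆ᵢ φᵢ) / (⨆ᵢⱼ εᵢⱼ)` over the theory `T`. -/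
structure Imaginary {L : FirstOrder.Language.{u, v}} (T : Set (Formula L 0)) where
  /-- the countable index set -/
  ι : Type
  [countable : Countable ι]
  /-- the number `nᵢ` of free variables -/
  ar : ι → ℕ
  /-- the formulas `φᵢ` -/
  dom : ∀ i, Formula L (ar i)
  /-- the formulas `εᵢⱼ` -/
  eqv : ∀ i j, Formula L (ar i + ar j)
  dom_sigma : ∀ i, (dom i).IsSigma1
  eqv_sigma : ∀ i j, (eqv i j).IsSigma1
  /-- `∀ x y, εᵢⱼ(x, y) → φᵢ(x) ∧ φⱼ(y)` -/
  eqv_dom : ∀ i j, Proves T (((eqv i j).imp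
    (((dom i).relabel (Fin.castAdd (ar j))).and ((dom j).relabel (Fin.natAdd (ar i))))).alls)
  /-- `∀ x, φᵢ(x) → εᵢᵢ(x, x)` -/
  eqv_refl : ∀ i, Proves T (((dom i).imp ((eqv i i).relabel (Fin.append id id))).alls)
  /-- `∀ x y, εᵢⱼ(x, y) → εⱼᵢ(y, x)` -/
  eqv_symm : ∀ i j, Proves T (((eqv i j).imp
    ((eqv j i).relabel (Fin.append (Fin.natAdd (ar i)) (Fin.castAdd (ar j))))).alls)
  /-- `∀ x y z, εᵢⱼ(x, y) ∧ εⱼₖ(y, z) → εᵢₖ(x, z)` -/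
  eqv_trans : ∀ i j k, Proves T (((((eqv i j).relabel (Fin.castAdd (ar k))).and
      ((eqv j k).relabel (Fin.append (fun q => (Fin.natAdd (ar i) q).castAdd (ar k))
        (Fin.natAdd (ar i + ar j))))).imp
    ((eqv i k).relabel (Fin.append (fun q => (Fin.castAdd (ar j) q).castAdd (ar k))
        (Fin.natAdd (ar i + ar j))))).alls)

attribute [instance] Imaginary.countable

/-- A `Σ₁`-definable function `Φ → Ψ`: a `Σ₁`-definable subsort `Θ = (θᵢₖ)` of `Φ × Ψ` which is
`T`-provably the graph of a function. -/
structure DefFun {L : FirstOrder.Language.{u, v}} {T : Set (Formula L 0)} (Φ Ψ : Imaginary T) where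
  /-- the formulas `θᵢₖ` -/
  graph : ∀ i k, Formula L (Φ.ar i + Ψ.ar k)
  graph_sigma : ∀ i k, (graph i k).IsSigma1
  /-- `∀ x y, θᵢₖ(x, y) → φᵢ(x) ∧ ψₖ(y)` -/
  graph_dom : ∀ i k, Proves T (((graph i k).imp
    (((Φ.dom i).relabel (Fin.castAdd (Ψ.ar k))).and
      ((Ψ.dom k).relabel (Fin.natAdd (Φ.ar i))))).alls)
  /-- `∀ x x' y y', θᵢₖ(x, y) ∧ εᵢⱼ(x, x') ∧ ηₖₗ(y, y') → θⱼₗ(x', y')`, where the variables are listed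
  in the order `x, x', y, y'` -/
  graph_inv : ∀ i j k l, Proves T (((((graph i k).relabel (m := Φ.ar i + Φ.ar j + (Ψ.ar k + Ψ.ar l))
        (Fin.append (fun q => (Fin.castAdd (Φ.ar j) q).castAdd (Ψ.ar k + Ψ.ar l))
          (fun q => Fin.natAdd (Φ.ar i + Φ.ar j) (q.castAdd (Ψ.ar l))))).and
      (((Φ.eqv i j).relabel (Fin.castAdd (Ψ.ar k + Ψ.ar l))).and
        ((Ψ.eqv k l).relabel (Fin.natAdd (Φ.ar i + Φ.ar j))))).imp
    ((graph j l).relabel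
      (Fin.append (fun q => (Fin.natAdd (Φ.ar i) q).castAdd (Ψ.ar k + Ψ.ar l))
        (fun q => Fin.natAdd (Φ.ar i + Φ.ar j) (q.natAdd (Ψ.ar k)))))).alls)
  /-- `∀ x, φᵢ(x) → ⋁ₖ ∃ y, θᵢₖ(x, y)` -/
  total : ∀ i, Proves T (((Φ.dom i).imp
    (Formula.sup fun k => Formula.exs (Ψ.ar k) (graph i k))).alls)
  /-- `∀ x y z, θᵢₖ(x, y) ∧ θᵢₗ(x, z) → ηₖₗ(y, z)` -/
  unique : ∀ i k l, Proves T (((((graph i k).relabel (Fin.castAdd (Ψ.ar l))).and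
      ((graph i l).relabel (Fin.append (fun q => (Fin.castAdd (Ψ.ar k) q).castAdd (Ψ.ar l))
        (Fin.natAdd (Φ.ar i + Ψ.ar k))))).imp
    ((Ψ.eqv k l).relabel (Fin.append (fun q => (Fin.natAdd (Φ.ar i) q).castAdd (Ψ.ar l))
        (Fin.natAdd (Φ.ar i + Ψ.ar k))))).alls)

section ImaginaryLemmas

theorem forall_append {N : Type w} {a b : ℕ} {P : (Fin (a + b) → N) → Prop} :
    (∀ x, P x) ↔ ∀ (y : Fin a → N) (z : Fin b → N), P (Fin.append y z) :=
  ⟨fun h y z => h _, fun h x => by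
    have := h (fun i => x (Fin.castAdd b i)) (fun i => x (Fin.natAdd a i))
    rwa [Fin.append_castAdd_natAdd] at this⟩

theorem append_comp {N : Type w} {a b m : ℕ} (x : Fin m → N) (f : Fin a → Fin m)
    (g : Fin b → Fin m) :
    (fun i => x (Fin.append f g i)) = Fin.append (fun i => x (f i)) (fun i => x (g i)) := by
  funext i
  refine Fin.addCases (fun i => ?_) (fun i => ?_) i <;> simp

variable {L : FirstOrder.Language.{u, v}} {T : Set (Formula L 0)}

namespace Imaginary

variable (Φ : Imaginary T) (N : Type w) [L.Structure N]

/-- The set `⨆ᵢ N^{nᵢ}`. -/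
abbrev Pt : Type w := Σ i : Φ.ι, (Fin (Φ.ar i) → N)

variable {N}

/-- The subset `⨆ᵢ φᵢ^N`. -/
def Dom (s : Φ.Pt N) : Prop := (Φ.dom s.1).Realize s.2

/-- The relation `⨆ᵢⱼ εᵢⱼ^N`. -/
def Eqv (s t : Φ.Pt N) : Prop := (Φ.eqv s.1 t.1).Realize (Fin.append s.2 t.2)

/-- The map induced by an isomorphism of structures. -/
def Pt.map {P : Type w'} [L.Structure P] {Φ : Imaginary T} (g : N ≃[L] P) (s : Φ.Pt N) : Φ.Pt P :=
  ⟨s.1, fun i => g (s.2 i)⟩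

theorem realize_append_equiv {P : Type w'} [L.Structure P] (g : N ≃[L] P) {a b : ℕ}
    (φ : Formula L (a + b)) (x : Fin a → N) (y : Fin b → N) :
    φ.Realize (Fin.append (fun i => g (x i)) (fun i => g (y i))) ↔ φ.Realize (Fin.append x y) := by
  rw [← Formula.realize_equiv g]
  refine Iff.of_eq (congrArg _ (funext fun i => ?_))
  refine Fin.addCases (fun i => ?_) (fun i => ?_) i <;> simp

variable {Φ}

theorem dom_map {P : Type w'} [L.Structure P] (g : N ≃[L] P) (s : Φ.Pt N) :
    Φ.Dom (s.map g) ↔ Φ.Dom s := Formula.realize_equiv g _ _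

theorem eqv_map {P : Type w'} [L.Structure P] (g : N ≃[L] P) (s t : Φ.Pt N) :
    Φ.Eqv (s.map g) (t.map g) ↔ Φ.Eqv s t := realize_append_equiv g _ _ _

variable [Countable N]

theorem Eqv.dom (hN : IsModel T N) {s t : Φ.Pt N} (h : Φ.Eqv s t) : Φ.Dom s ∧ Φ.Dom t := by
  have := (Φ.eqv_dom s.1 t.1).realize_alls N hN (Fin.append s.2 t.2)
  simp only [Formula.realize_imp, Formula.Realize, Formula.realize_relabel, Fin.append_left,
    Fin.append_right] at this
  exact this h

theorem Eqv.refl (hN : IsModel T N) {s : Φ.Pt N} (h : Φ.Dom s) : Φ.Eqv s s := by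
  have := (Φ.eqv_refl s.1).realize_alls N hN s.2
  simp only [Formula.realize_imp, Formula.realize_relabel, append_comp, id] at this
  exact this h

theorem Eqv.symm (hN : IsModel T N) {s t : Φ.Pt N} (h : Φ.Eqv s t) : Φ.Eqv t s := by
  have := (Φ.eqv_symm s.1 t.1).realize_alls N hN (Fin.append s.2 t.2)
  simp only [Formula.realize_imp, Formula.realize_relabel, append_comp, Fin.append_left,
    Fin.append_right] at this
  exact this h

theorem Eqv.trans (hN : IsModel T N) {s t r : Φ.Pt N} (h : Φ.Eqv s t) (h' : Φ.Eqv t r) : Φ.Eqv s r := by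
  have := (Φ.eqv_trans s.1 t.1 r.1).realize_alls N hN (Fin.append (Fin.append s.2 t.2) r.2)
  simp only [Formula.realize_imp, Formula.Realize, Formula.realize_relabel, append_comp,
    Fin.append_left, Fin.append_right] at this
  exact this ⟨h, h'⟩

end Imaginary

namespace DefFun

variable {Φ Ψ Ξ : Imaginary T} (Θ : DefFun Φ Ψ) {N : Type w} [L.Structure N]

/-- The graph `⨆ᵢₖ θᵢₖ^N`. -/
def Graph (s : Φ.Pt N) (t : Ψ.Pt N) : Prop := (Θ.graph s.1 t.1).Realize (Fin.append s.2 t.2)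

variable {Θ}

theorem graph_map {P : Type w'} [L.Structure P] (g : N ≃[L] P) (s : Φ.Pt N) (t : Ψ.Pt N) :
    Θ.Graph (s.map g) (t.map g) ↔ Θ.Graph s t := Imaginary.realize_append_equiv g _ _ _

section

variable [Countable N]

theorem Graph.dom (hN : IsModel T N) {s : Φ.Pt N} {t : Ψ.Pt N} (h : Θ.Graph s t) : Φ.Dom s ∧ Ψ.Dom t := by
  have := (Θ.graph_dom s.1 t.1).realize_alls N hN (Fin.append s.2 t.2)
  simp only [Formula.realize_imp, Formula.Realize, Formula.realize_relabel, Fin.append_left,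
    Fin.append_right] at this
  exact this h

theorem Graph.inv (hN : IsModel T N) {s s' : Φ.Pt N} {t t' : Ψ.Pt N} (h : Θ.Graph s t) (hs : Φ.Eqv s s')
    (ht : Ψ.Eqv t t') : Θ.Graph s' t' := by
  have := (Θ.graph_inv s.1 s'.1 t.1 t'.1).realize_alls N hN
    (Fin.append (Fin.append s.2 s'.2) (Fin.append t.2 t'.2))
  simp only [Formula.realize_imp, Formula.Realize, Formula.realize_relabel, append_comp,
    Fin.append_left, Fin.append_right] at this
  exact this ⟨h, hs, ht⟩

theorem Graph.total (hN : IsModel T N) (Θ : DefFun Φ Ψ) {s : Φ.Pt N} (h : Φ.Dom s) : ∃ t, Θ.Graph s t := by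
  have := (Θ.total s.1).realize_alls N hN s.2
  simp only [Formula.realize_imp, Formula.Realize, Formula.realize_exs] at this
  obtain ⟨k, y, hy⟩ := this h
  exact ⟨⟨k, y⟩, hy⟩

theorem Graph.unique (hN : IsModel T N) {s : Φ.Pt N} {t t' : Ψ.Pt N} (h : Θ.Graph s t) (h' : Θ.Graph s t') :
    Ψ.Eqv t t' := by
  have := (Θ.unique s.1 t.1 t'.1).realize_alls N hN (Fin.append (Fin.append s.2 t.2) t'.2)
  simp only [Formula.realize_imp, Formula.Realize, Formula.realize_relabel, append_comp,
    Fin.append_left, Fin.append_right] at this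
  exact this ⟨h, h'⟩

theorem Graph.congr (hN : IsModel T N) {s s' : Φ.Pt N} {t t' : Ψ.Pt N} (h : Θ.Graph s t) (h' : Θ.Graph s' t')
    (hs : Φ.Eqv s s') : Ψ.Eqv t t' :=
  (h.inv hN hs (Imaginary.Eqv.refl hN (h.dom hN).2)).unique hN h'

end

/-- `T`-provable equivalence of `Σ₁`-definable functions. -/
instance setoid (Φ Ψ : Imaginary T) : Setoid (DefFun Φ Ψ) where
  r Θ Θ' := ∀ i k, Proves T (((Θ.graph i k).iff (Θ'.graph i k)).alls)
  iseqv :=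
    { refl := fun Θ i k => proves_alls.2 fun N _ _ hN x => by simp [Formula.realize_iff]
      symm := fun h i k => proves_alls.2 fun N _ _ hN x => by
        have := proves_alls.1 (h i k) N hN x
        rw [Formula.realize_iff] at this ⊢
        exact this.symm
      trans := fun h h' i k => proves_alls.2 fun N _ _ hN x => by
        have h1 := proves_alls.1 (h i k) N hN x
        have h2 := proves_alls.1 (h' i k) N hN x
        rw [Formula.realize_iff] at h1 h2 ⊢
        exact h1.trans h2 }

theorem equiv_graph {Θ Θ' : DefFun Φ Ψ} (h : Θ ≈ Θ') [Countable N] (hN : IsModel T N)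
    (s : Φ.Pt N) (t : Ψ.Pt N) : Θ.Graph s t ↔ Θ'.Graph s t :=
  (Formula.realize_iff _ _ _).1 ((h s.1 t.1).realize_alls N hN (Fin.append s.2 t.2))

theorem equiv_of_graph {Θ Θ' : DefFun Φ Ψ}
    (h : ∀ (N : Type) [L.Structure N] [Countable N], IsModel T N →
      ∀ (s : Φ.Pt N) (t : Ψ.Pt N), Θ.Graph s t ↔ Θ'.Graph s t) : Θ ≈ Θ' := fun i k =>
  proves_alls.2 fun N _ _ hN => forall_append.2 fun x y =>
    (Formula.realize_iff _ _ _).2 (h N hN ⟨i, x⟩ ⟨k, y⟩)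

/-- The identity function of `Φ`, with graph `⨆ᵢⱼ εᵢⱼ`. -/
def id (Φ : Imaginary T) : DefFun Φ Φ where
  graph := Φ.eqv
  graph_sigma := Φ.eqv_sigma
  graph_dom := Φ.eqv_dom
  graph_inv i j k l := proves_alls.2 fun N _ _ hN => forall_append.2 fun z w => by
    revert z w
    rw [forall_append]; intro x x'
    rw [forall_append]; intro y y'
    simp only [Formula.realize_imp, Formula.Realize, Formula.realize_relabel, append_comp,
      Fin.append_left, Fin.append_right]
    rintro ⟨h, hs, ht⟩
    exact (Imaginary.Eqv.symm hN (s := ⟨i, x⟩) (t := ⟨j, x'⟩) hs).trans hN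
      (Imaginary.Eqv.trans hN (s := ⟨i, x⟩) (t := ⟨k, y⟩) (r := ⟨l, y'⟩) h ht)
  total i := proves_alls.2 fun N _ _ hN x => by
    simp only [Formula.realize_imp, Formula.Realize, Formula.realize_exs]
    exact fun h => ⟨i, x, Imaginary.Eqv.refl hN (s := ⟨i, x⟩) h⟩
  unique i k l := proves_alls.2 fun N _ _ hN => forall_append.2 fun z y' => by
    revert z
    rw [forall_append]; intro x y
    simp only [Formula.realize_imp, Formula.Realize, Formula.realize_relabel, append_comp,
      Fin.append_left, Fin.append_right]
    rintro ⟨h, h'⟩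
    exact (Imaginary.Eqv.symm hN (s := ⟨i, x⟩) (t := ⟨k, y⟩) h).trans hN
      (r := ⟨l, y'⟩) h'

/-- The formulas `⋁ⱼ ∃ y, θᵢⱼ(x, y) ∧ θ'ⱼₖ(y, z)`. -/
def compGraph (Θ : DefFun Φ Ψ) (Θ' : DefFun Ψ Ξ) (i : Φ.ι) (k : Ξ.ι) :
    Formula L (Φ.ar i + Ξ.ar k) :=
  Formula.sup fun j : Ψ.ι => Formula.exs (Ψ.ar j)
    (((Θ.graph i j).relabel (Fin.append (fun q => (Fin.castAdd (Ξ.ar k) q).castAdd (Ψ.ar j))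
        (Fin.natAdd (Φ.ar i + Ξ.ar k)))).and
      ((Θ'.graph j k).relabel (Fin.append (Fin.natAdd (Φ.ar i + Ξ.ar k))
        (fun q => (Fin.natAdd (Φ.ar i) q).castAdd (Ψ.ar j)))))

theorem realize_compGraph (Θ : DefFun Φ Ψ) (Θ' : DefFun Ψ Ξ) (s : Φ.Pt N) (r : Ξ.Pt N) :
    (compGraph Θ Θ' s.1 r.1).Realize (Fin.append s.2 r.2) ↔
      ∃ t : Ψ.Pt N, Θ.Graph s t ∧ Θ'.Graph t r := by
  simp only [compGraph, Formula.Realize, Formula.realize_exs, Formula.realize_relabel,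
    append_comp, Fin.append_left, Fin.append_right]
  exact ⟨fun ⟨j, y, h⟩ => ⟨⟨j, y⟩, h⟩, fun ⟨t, h⟩ => ⟨t.1, t.2, h⟩⟩

/-- The composite of `Σ₁`-definable functions. -/
def comp (Θ : DefFun Φ Ψ) (Θ' : DefFun Ψ Ξ) : DefFun Φ Ξ where
  graph := compGraph Θ Θ'
  graph_sigma i k := fun j => Formula.IsSigma1.exs _
    ⟨(Θ.graph_sigma i j).relabel _, (Θ'.graph_sigma j k).relabel _⟩
  graph_dom i k := proves_alls.2 fun N _ _ hN => forall_append.2 fun x y => by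
    simp only [Formula.realize_imp, Formula.Realize, Formula.realize_relabel, Fin.append_left,
      Fin.append_right]
    intro h
    obtain ⟨t, h1, h2⟩ := (realize_compGraph Θ Θ' ⟨i, x⟩ ⟨k, y⟩).1 h
    exact ⟨(h1.dom hN).1, (h2.dom hN).2⟩
  graph_inv i j k l := proves_alls.2 fun N _ _ hN => forall_append.2 fun z w => by
    revert z w
    rw [forall_append]; intro x x'
    rw [forall_append]; intro y y'
    simp only [Formula.realize_imp, Formula.Realize, Formula.realize_relabel, append_comp,
      Fin.append_left, Fin.append_right]
    rintro ⟨h, hs, ht⟩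
    obtain ⟨t, h1, h2⟩ := (realize_compGraph Θ Θ' ⟨i, x⟩ ⟨k, y⟩).1 h
    have htt := Imaginary.Eqv.refl hN (h1.dom hN).2
    exact (realize_compGraph Θ Θ' ⟨j, x'⟩ ⟨l, y'⟩).2
      ⟨t, h1.inv hN (s' := ⟨j, x'⟩) hs htt, h2.inv hN htt (t' := ⟨l, y'⟩) ht⟩
  total i := proves_alls.2 fun N _ _ hN x => by
    simp only [Formula.realize_imp, Formula.Realize, Formula.realize_exs]
    intro h
    obtain ⟨t, h1⟩ := Graph.total hN Θ (s := ⟨i, x⟩) h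
    obtain ⟨r, h2⟩ := Graph.total hN Θ' (h1.dom hN).2
    exact ⟨r.1, r.2, (realize_compGraph Θ Θ' ⟨i, x⟩ r).2 ⟨t, h1, h2⟩⟩
  unique i k l := proves_alls.2 fun N _ _ hN => forall_append.2 fun z y' => by
    revert z
    rw [forall_append]; intro x y
    simp only [Formula.realize_imp, Formula.Realize, Formula.realize_relabel, append_comp,
      Fin.append_left, Fin.append_right]
    rintro ⟨h, h'⟩
    obtain ⟨t, h1, h2⟩ := (realize_compGraph Θ Θ' ⟨i, x⟩ ⟨k, y⟩).1 h
    obtain ⟨t', h1', h2'⟩ := (realize_compGraph Θ Θ' ⟨i, x⟩ ⟨l, y'⟩).1 h'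
    exact Graph.congr hN h2 h2' (h1.unique hN h1')

theorem graph_comp (Θ : DefFun Φ Ψ) (Θ' : DefFun Ψ Ξ) (s : Φ.Pt N) (r : Ξ.Pt N) :
    (Θ.comp Θ').Graph s r ↔ ∃ t : Ψ.Pt N, Θ.Graph s t ∧ Θ'.Graph t r :=
  realize_compGraph Θ Θ' s r

end DefFun

/-- The syntactic category (σ-pretopos) of `T`: objects are the `Σ₁` imaginaries over `T`, morphisms
are the `Σ₁`-definable functions modulo `T`-provable equivalence. -/
instance Imaginary.category : Category (Imaginary T) where
  Hom Φ Ψ := Quotient (DefFun.setoid Φ Ψ)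
  id Φ := ⟦DefFun.id Φ⟧
  comp f g := Quotient.map₂ DefFun.comp (fun Θ₁ Θ₂ h Θ₁' Θ₂' h' =>
    DefFun.equiv_of_graph fun N _ _ hN s r => by
      simp only [DefFun.graph_comp, DefFun.equiv_graph h hN, DefFun.equiv_graph h' hN]) f g
  id_comp f := by
    induction f using Quotient.inductionOn with | _ Θ
    refine Quotient.sound (DefFun.equiv_of_graph fun N _ _ hN s r => ?_)
    rw [DefFun.graph_comp]
    refine ⟨fun ⟨t, h1, h2⟩ => ?_, fun h => ⟨s, Imaginary.Eqv.refl hN (h.dom hN).1, h⟩⟩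
    exact h2.inv hN (Imaginary.Eqv.symm hN h1) (Imaginary.Eqv.refl hN (h2.dom hN).2)
  comp_id f := by
    induction f using Quotient.inductionOn with | _ Θ
    refine Quotient.sound (DefFun.equiv_of_graph fun N _ _ hN s r => ?_)
    rw [DefFun.graph_comp]
    refine ⟨fun ⟨t, h1, h2⟩ => ?_, fun h => ⟨r, h, Imaginary.Eqv.refl hN (h.dom hN).2⟩⟩
    exact h1.inv hN (Imaginary.Eqv.refl hN (h1.dom hN).1) h2
  assoc f g h := by
    induction f using Quotient.inductionOn with | _ Θ₁
    induction g using Quotient.inductionOn with | _ Θ₂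
    induction h using Quotient.inductionOn with | _ Θ₃
    refine Quotient.sound (DefFun.equiv_of_graph fun N _ _ hN s r => ?_)
    simp only [DefFun.graph_comp]
    exact ⟨fun ⟨t, ⟨t', h1, h2⟩, h3⟩ => ⟨t', h1, t, h2, h3⟩,
      fun ⟨t', h1, t, h2, h3⟩ => ⟨t, ⟨t', h1, h2⟩, h3⟩⟩

end ImaginaryLemmas

/-! ### Étale structures -/

/-- The fiber power `M^n_X = {(x, a₀, …, a_{n-1}) | p(aᵢ) = x}`, as a subspace of `X × Mⁿ`. -/
abbrev FiberPow {X M : Type w} (p : M → X) (n : ℕ) : Type w :=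
  {z : X × (Fin n → M) // ∀ i, p (z.2 i) = z.1}

/-- An étale `L`-structure with underlying étale space `p : M → X`. -/
structure EtaleStructure (L : FirstOrder.Language.{u, v}) (X M : Type w) [TopologicalSpace X]
    [TopologicalSpace M] where
  /-- the projection map -/
  proj : M → X
  isLocalHomeomorph : IsLocalHomeomorph proj
  /-- the interpretation of the function symbols -/
  funMap : ∀ {n : ℕ}, L.Functions n → FiberPow proj n → M
  proj_funMap : ∀ {n : ℕ} (f : L.Functions n) (z : FiberPow proj n), proj (funMap f z) = z.1.1
  continuous_funMap : ∀ {n : ℕ} (f : L.Functions n), Continuous (funMap f)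
  /-- the interpretation of the relation symbols -/
  relMap : ∀ {n : ℕ}, L.Relations n → Set (FiberPow proj n)
  isOpen_relMap : ∀ {n : ℕ} (R : L.Relations n), IsOpen (relMap R)

section Etale

variable {L : FirstOrder.Language.{u, v}} {X M : Type w} [TopologicalSpace X] [TopologicalSpace M]

namespace EtaleStructure

variable (S : EtaleStructure L X M)

/-- The fiber `M_x`. -/
abbrev Fiber (x : X) : Type w := {a : M // S.proj a = x}

/-- The point of `M^n_X` given by a base point and a tuple in its fiber. -/
def tuple {n : ℕ} (x : X) (a : Fin n → S.Fiber x) : FiberPow S.proj n :=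
  ⟨(x, fun i => (a i).1), fun i => (a i).2⟩

/-- The tuple in the fiber given by a point of `M^n_X`. -/
def coords {n : ℕ} (z : FiberPow S.proj n) : Fin n → S.Fiber z.1.1 := fun i => ⟨z.1.2 i, z.2 i⟩

/-- The structure on the fiber `M_x`. -/
instance fiberStructure (x : X) : L.Structure (S.Fiber x) where
  funMap f a := ⟨S.funMap f (S.tuple x a), S.proj_funMap f (S.tuple x a)⟩
  RelMap R a := S.tuple x a ∈ S.relMap R

/-- The interpretation `φ^M ⊆ M^n_X` of a formula, whose fibers are the ordinary interpretations. -/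
def interp {n : ℕ} (φ : Formula L n) : Set (FiberPow S.proj n) := {z | φ.Realize (S.coords z)}

/-- The isomorphism groupoid `Iso_X(M)`: the triples `(x, y, g)` with `g : M_x ≅ M_y`. -/
structure IsoGpd where
  /-- domain -/
  dom : X
  /-- codomain -/
  cod : X
  /-- the isomorphism of fibers -/
  map : S.Fiber dom ≃[L] S.Fiber cod

/-- The set `⟦U ↦ V⟧` of all `g : M_x ≅ M_y` with `g(U_x) ∩ V_y ≠ ∅`. -/
def mapsSet (U V : Set M) : Set S.IsoGpd :=
  {g | ∃ a : S.Fiber g.dom, a.1 ∈ U ∧ (g.map a).1 ∈ V}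

/-- The topology of `Iso_X(M)`, generated by the two projections to `X` and the sets `⟦U ↦ V⟧`. -/
instance isoGpdTopology : TopologicalSpace S.IsoGpd :=
  TopologicalSpace.generateFrom
    ({W | ∃ U : Set X, IsOpen U ∧ W = {g | g.dom ∈ U}} ∪
      {W | ∃ U : Set X, IsOpen U ∧ W = {g | g.cod ∈ U}} ∪
      {W | ∃ U V : Set M, IsOpen U ∧ IsOpen V ∧ W = S.mapsSet U V})

/-- The action of `Iso_X(M)` on `M^n_X`. -/
def actPow {n : ℕ} (g : S.IsoGpd) (z : FiberPow S.proj n) (h : z.1.1 = g.dom) :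
    FiberPow S.proj n :=
  S.tuple g.cod fun i => g.map ⟨z.1.2 i, (z.2 i).trans h⟩

/-- `M` has `Σ₁` saturations: the saturation `Iso_X(M) · U` of every open `U ⊆ M^n_X` is
`Σ₁`-definable. -/
def HasSigma1Saturations : Prop :=
  ∀ (n : ℕ) (U : Set (FiberPow S.proj n)), IsOpen U → ∃ φ : Formula L n, φ.IsSigma1 ∧
    {z | ∃ (g : S.IsoGpd) (a : FiberPow S.proj n) (h : a.1.1 = g.dom), a ∈ U ∧ S.actPow g a h = z} =
      S.interp φ

/-- `X` parametrizes models of `T` via `M`: the countable models of `T` are exactly the countable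
structures isomorphic to some fiber of `M`. -/
def Parametrizes (T : Set (Formula L 0)) : Prop :=
  ∀ (N : Type) [L.Structure N] [Countable N],
    IsModel T N ↔ ∃ x : X, Nonempty (N ≃[L] S.Fiber x)

/-- `M` is an étale model of `T`. -/
def IsEtaleModel (T : Set (Formula L 0)) : Prop :=
  ∀ σ ∈ T, S.interp σ = Set.univ

/-- An étale `Iso_X(M)`-space over `X`: an étale space over `X` with a jointly continuous action of
`Iso_X(M)`, each `g : M_x ≅ M_y` acting from the fiber over `x` to the fiber over `y`. -/
structure EtaleSpace where
  /-- the total space -/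
  carrier : Type w
  [topology : TopologicalSpace carrier]
  /-- the projection map -/
  proj : carrier → X
  isLocalHomeomorph : IsLocalHomeomorph proj
  /-- the action -/
  act : (g : S.IsoGpd) → (a : carrier) → proj a = g.dom → carrier
  proj_act : ∀ g a h, proj (act g a h) = g.cod
  act_id : ∀ a, act ⟨proj a, proj a, FirstOrder.Language.Equiv.refl L _⟩ a rfl = a
  act_comp : ∀ {x y z : X} (f : S.Fiber x ≃[L] S.Fiber y) (g : S.Fiber y ≃[L] S.Fiber z) (a : carrier)
    (h : proj a = x), act ⟨x, z, g.comp f⟩ a h = act ⟨y, z, g⟩ (act ⟨x, y, f⟩ a h) (proj_act _ _ _)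
  continuous_act : Continuous fun q : {q : S.IsoGpd × carrier // proj q.2 = q.1.dom} =>
    act q.1.1 q.1.2 q.2

attribute [instance] EtaleSpace.topology

variable {S}

/-- Morphisms of étale `Iso_X(M)`-spaces: equivariant continuous maps over `X`. -/
@[ext]
structure EtaleSpace.Hom (A B : S.EtaleSpace) where
  /-- the underlying map -/
  toFun : A.carrier → B.carrier
  continuous_toFun : Continuous toFun
  proj_toFun : ∀ a, B.proj (toFun a) = A.proj a
  map_act : ∀ g a h, toFun (A.act g a h) = B.act g (toFun a) ((proj_toFun a).trans h)

instance EtaleSpace.category : Category S.EtaleSpace where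
  Hom A B := EtaleSpace.Hom A B
  id A := ⟨fun a => a, continuous_id, fun _ => rfl, fun _ _ _ => rfl⟩
  comp f g := ⟨fun a => g.toFun (f.toFun a), g.continuous_toFun.comp f.continuous_toFun,
    fun a => by rw [g.proj_toFun, f.proj_toFun], fun k a h => by rw [f.map_act, g.map_act]⟩

/-- The property of being a second-countable étale `Iso_X(M)`-space. -/
def secondCountable (S : EtaleStructure L X M) : ObjectProperty S.EtaleSpace :=
  fun A => SecondCountableTopology A.carrier

/-! #### `Σ₁` formulas define open sets -/

theorem isOpenMap_proj (S : EtaleStructure L X M) : IsOpenMap S.proj :=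
  S.isLocalHomeomorph.isOpenMap

theorem countable_fiber [SecondCountableTopology M] (S : EtaleStructure L X M) (x : X) :
    Countable (S.Fiber x) := by
  have : DiscreteTopology {a : M // S.proj a = x} := by
    refine discreteTopology_iff_isOpen_singleton.2 fun a => ?_
    obtain ⟨U, hU, haU, hinj⟩ := S.isLocalHomeomorph.isLocallyInjective a.1
    refine ⟨U, hU, Set.ext fun b => ⟨fun hb => ?_, ?_⟩⟩
    · exact Subtype.ext (hinj hb haU (b.2.trans a.2.symm))
    · rintro rfl
      exact haU
  have : SecondCountableTopology {a : M // S.proj a = x} := inferInstance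
  exact (TopologicalSpace.separableSpace_iff_countable (α := {a : M // S.proj a = x})).1
    inferInstance

theorem continuous_term (S : EtaleStructure L X M) {n : ℕ} (t : L.Term (Fin n)) :
    Continuous fun z : FiberPow S.proj n => (t.realize (S.coords z)).1 := by
  induction t with
  | var i => exact (continuous_apply i).comp (continuous_snd.comp continuous_subtype_val)
  | func f ts ih =>
    refine (S.continuous_funMap f).comp (Continuous.subtype_mk ?_ _)
    exact (continuous_fst.comp continuous_subtype_val).prodMk (continuous_pi ih)

/-- Projecting an open set of pairs over `X` along an open map is open. -/
theorem isOpen_exists {A B : Type*} [TopologicalSpace A] [TopologicalSpace B] {p : A → X}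
    {q : B → X} (hp : Continuous p) (hq : IsOpenMap q) {R : Set {c : A × B // p c.1 = q c.2}}
    (hR : IsOpen R) : IsOpen {a | ∃ b, ∃ h : p a = q b, ⟨(a, b), h⟩ ∈ R} := by
  rw [isOpen_iff_mem_nhds]
  rintro a ⟨b, h, hab⟩
  obtain ⟨O, hO, rfl⟩ := hR
  obtain ⟨U, V, hU, hV, ha, hb, hUV⟩ := isOpen_prod_iff.1 hO a b hab
  filter_upwards [hU.mem_nhds ha, (hp.isOpen_preimage _ (hq V hV)).mem_nhds ⟨b, hb, h.symm⟩]
    with a' ha' hb'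
  obtain ⟨b', hb', h'⟩ := hb'
  exact ⟨b', h'.symm, hUV ⟨ha', hb'⟩⟩

theorem continuous_base (S : EtaleStructure L X M) (n : ℕ) :
    Continuous fun z : FiberPow S.proj n => z.1.1 := continuous_fst.comp continuous_subtype_val

theorem continuous_coord (S : EtaleStructure L X M) (n : ℕ) (i : Fin n) :
    Continuous fun z : FiberPow S.proj n => z.1.2 i :=
  (continuous_apply i).comp (continuous_snd.comp continuous_subtype_val)

/-- The map `M^n_X ×_X M → M^{n+1}_X`. -/
def snocPow (S : EtaleStructure L X M) {n : ℕ} (z : FiberPow S.proj n) (a : M)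
    (h : z.1.1 = S.proj a) : FiberPow S.proj (n + 1) :=
  ⟨(z.1.1, Fin.snoc (α := fun _ => M) z.1.2 a), fun i => by
    refine Fin.lastCases ?_ (fun i => ?_) i
    · simpa using h.symm
    · simpa using z.2 i⟩

theorem isOpen_exists_snocPow (S : EtaleStructure L X M) {n : ℕ}
    {W : Set (FiberPow S.proj (n + 1))} (hW : IsOpen W) :
    IsOpen {z : FiberPow S.proj n | ∃ a, ∃ h : z.1.1 = S.proj a, S.snocPow z a h ∈ W} := by
  refine isOpen_exists (S.continuous_base n) S.isOpenMap_proj (R := {c | S.snocPow c.1.1 c.1.2 c.2 ∈ W})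
    (hW.preimage (f := fun c : {c : FiberPow S.proj n × M // c.1.1.1 = S.proj c.2} =>
      S.snocPow c.1.1 c.1.2 c.2) ?_)
  refine Continuous.subtype_mk (Continuous.prodMk ?_ ?_) _
  · exact (S.continuous_base n).comp (continuous_fst.comp continuous_subtype_val)
  · exact Continuous.finSnoc (A := fun _ => M)
      (continuous_snd.comp (continuous_subtype_val.comp
        (continuous_fst.comp continuous_subtype_val)))
      (continuous_snd.comp continuous_subtype_val)

theorem coords_snocPow (S : EtaleStructure L X M) {n : ℕ} (z : FiberPow S.proj n) (a : M)
    (h : z.1.1 = S.proj a) : S.coords (S.snocPow z a h) =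
      Fin.snoc (α := fun _ => S.Fiber z.1.1) (S.coords z) ⟨a, h.symm⟩ := by
  funext i
  apply Subtype.ext
  refine Fin.lastCases ?_ (fun i => ?_) i
  · rw [Fin.snoc_last (α := fun _ => S.Fiber z.1.1)]
    exact Fin.snoc_last (α := fun _ => M) _ _
  · rw [Fin.snoc_castSucc (α := fun _ => S.Fiber z.1.1)]
    exact Fin.snoc_castSucc (α := fun _ => M) _ _ _

theorem isOpenMap_base (S : EtaleStructure L X M) (n : ℕ) :
    IsOpenMap fun z : FiberPow S.proj n => z.1.1 := by
  induction n with
  | zero =>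
    rintro _ ⟨O, hO, rfl⟩
    convert hO.preimage (Continuous.prodMk_left (Fin.elim0 : Fin 0 → M)) using 1
    ext x
    constructor
    · rintro ⟨z, hz, rfl⟩
      change (z.1.1, _) ∈ O
      rwa [Subsingleton.elim Fin.elim0 z.1.2]
    · exact fun hx => ⟨⟨(x, Fin.elim0), fun i => i.elim0⟩, hx, rfl⟩
  | succ n ih =>
    intro W hW
    convert ih _ (S.isOpen_exists_snocPow hW) using 1
    ext x
    constructor
    · rintro ⟨z, hz, rfl⟩
      refine ⟨⟨(z.1.1, Fin.init (α := fun _ => M) z.1.2), fun i => z.2 i.castSucc⟩,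
        ⟨z.1.2 (Fin.last n), (z.2 _).symm, ?_⟩, rfl⟩
      convert hz using 1
      exact Subtype.ext (Prod.ext rfl (Fin.snoc_init_self _))
    · rintro ⟨z, ⟨a, h, hz⟩, rfl⟩
      exact ⟨_, hz, rfl⟩

theorem isOpen_interp (S : EtaleStructure L X M) {n : ℕ} {φ : Formula L n} (hφ : φ.IsSigma1) :
    IsOpen (S.interp φ) := by
  induction φ with
  | equal s t =>
    have := S.isLocalHomeomorph.isLocallyInjective.isOpen_eqLocus
      (g₁ := fun z => (s.realize (S.coords z)).1) (g₂ := fun z => (t.realize (S.coords z)).1)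
      (S.continuous_term s) (S.continuous_term t) (by
        funext z
        exact (s.realize (S.coords z)).2.trans (t.realize (S.coords z)).2.symm)
    convert this using 1
    ext z
    exact Subtype.ext_iff
  | rel R ts =>
    refine (S.isOpen_relMap R).preimage
      (f := fun z => S.tuple z.1.1 fun i => (ts i).realize (S.coords z)) ?_
    exact Continuous.subtype_mk
      ((S.continuous_base _).prodMk (continuous_pi fun i => S.continuous_term (ts i))) _
  | top => convert isOpen_univ; exact Set.eq_univ_of_forall fun _ => trivial
  | and φ ψ h1 h2 => exact (h1 hφ.1).inter (h2 hφ.2)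
  | not φ _ => exact hφ.elim
  | sup φ ih =>
    convert isOpen_iUnion fun i => ih i (hφ i)
    ext z
    simp [interp, Formula.Realize]
  | @ex n φ ih =>
    convert S.isOpen_exists_snocPow (ih hφ) using 1
    ext z
    constructor
    · rintro ⟨a, ha⟩
      refine ⟨a.1, a.2.symm, ?_⟩
      change φ.Realize (S.coords _)
      rw [coords_snocPow]
      exact ha
    · rintro ⟨a, h, ha⟩
      refine ⟨⟨a, h.symm⟩, ?_⟩
      change φ.Realize (S.coords _) at ha
      rwa [coords_snocPow] at ha

/-! #### The action on fiber powers -/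

theorem continuous_actPow (S : EtaleStructure L X M) (n : ℕ) :
    Continuous fun q : {q : S.IsoGpd × FiberPow S.proj n // q.2.1.1 = q.1.dom} =>
      S.actPow q.1.1 q.1.2 q.2 := by
  refine Continuous.subtype_mk (Continuous.prodMk ?_ (continuous_pi fun i => ?_)) _
  · refine Continuous.comp (g := IsoGpd.cod) ?_ (continuous_fst.comp continuous_subtype_val)
    exact ⟨fun U hU => TopologicalSpace.isOpen_generateFrom_of_mem (.inl (.inr ⟨U, hU, rfl⟩))⟩
  · rw [continuous_iff_continuousAt]
    rintro ⟨⟨g, z⟩, h⟩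
    rw [ContinuousAt, tendsto_nhds]
    intro V hV hz
    obtain ⟨U, hU, haU, hinj⟩ := S.isLocalHomeomorph.isLocallyInjective (z.1.2 i)
    have h1 : IsOpen {q : {q : S.IsoGpd × FiberPow S.proj n // q.2.1.1 = q.1.dom} |
        q.1.1 ∈ S.mapsSet U V} :=
      (TopologicalSpace.isOpen_generateFrom_of_mem (.inr ⟨U, V, hU, hV, rfl⟩)).preimage
        (continuous_fst.comp continuous_subtype_val)
    have h2 : IsOpen {q : {q : S.IsoGpd × FiberPow S.proj n // q.2.1.1 = q.1.dom} |
        q.1.2.1.2 i ∈ U} :=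
      hU.preimage ((S.continuous_coord n i).comp (continuous_snd.comp continuous_subtype_val))
    filter_upwards [(h1.inter h2).mem_nhds
      ⟨⟨⟨z.1.2 i, (z.2 i).trans h⟩, haU, hz⟩, haU⟩]
    rintro ⟨⟨g', z'⟩, h'⟩ ⟨⟨a, ha, hga⟩, hz'⟩
    have : a = ⟨z'.1.2 i, (z'.2 i).trans h'⟩ :=
      Subtype.ext (hinj ha hz' (a.2.trans ((z'.2 i).trans h').symm))
    rw [this] at hga
    exact hga

theorem realize_actPow (S : EtaleStructure L X M) {n : ℕ} (φ : Formula L n) (g : S.IsoGpd)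
    (z : FiberPow S.proj n) (h : z.1.1 = g.dom) : S.actPow g z h ∈ S.interp φ ↔ z ∈ S.interp φ := by
  obtain ⟨⟨x, a⟩, hz⟩ := z
  obtain ⟨x', y, g⟩ := g
  obtain rfl : x = x' := h
  exact Formula.realize_equiv g φ fun i => ⟨a i, hz i⟩

theorem IsEtaleModel.isModel {S : EtaleStructure L X M} {T : Set (Formula L 0)}
    (hS : S.IsEtaleModel T) (x : X) : IsModel T (S.Fiber x) := fun σ hσ => by
  have : S.tuple x Fin.elim0 ∈ S.interp σ := by rw [hS σ hσ]; trivial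
  rwa [interp, Set.mem_ofPred_eq, Subsingleton.elim (S.coords (S.tuple x Fin.elim0))
    (Fin.elim0 : Fin 0 → S.Fiber x)] at this

theorem Parametrizes.isEtaleModel [SecondCountableTopology M] {S : EtaleStructure L X M}
    {T : Set (Formula L 0)} (h : S.Parametrizes T) : S.IsEtaleModel T := by
  refine fun σ hσ => Set.eq_univ_of_forall fun z => ?_
  have := S.countable_fiber z.1.1
  let e₀ := equivShrink.{0} (S.Fiber z.1.1)
  let : L.Structure (Shrink.{0} (S.Fiber z.1.1)) := e₀.inducedStructure
  let e : S.Fiber z.1.1 ≃[L] Shrink.{0} (S.Fiber z.1.1) := e₀.inducedStructureEquiv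
  have : Countable (Shrink.{0} (S.Fiber z.1.1)) := e₀.symm.injective.countable
  have := ((h (Shrink.{0} (S.Fiber z.1.1))).2 ⟨z.1.1, ⟨e.symm⟩⟩).of_equiv e.symm σ hσ
  rwa [Subsingleton.elim (Fin.elim0 : Fin 0 → S.Fiber z.1.1) (S.coords z)] at this

/-! #### The interpretation of an imaginary in an étale model -/

section Interp

variable (S) {T : Set (Formula L 0)} (Φ Ψ : Imaginary T)

/-- The concatenation `M^m_X ×_X M^n_X → M^{m+n}_X`. -/
def append {m n : ℕ} (y : FiberPow S.proj m) (z : FiberPow S.proj n) (h : y.1.1 = z.1.1) :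
    FiberPow S.proj (m + n) :=
  ⟨(y.1.1, Fin.append y.1.2 z.1.2), fun i => by
    refine Fin.addCases (fun i => ?_) (fun i => ?_) i
    · simpa using y.2 i
    · simpa [h] using z.2 i⟩

/-- The étale space `⨆ᵢ φᵢ^M`. -/
abbrev PreSpace : Type w := Σ i : Φ.ι, S.interp (Φ.dom i)

variable {Φ Ψ}

/-- The base point. -/
def preProj (a : S.PreSpace Φ) : X := a.2.1.1.1

/-- The tuple in the fiber. -/
def prePt (a : S.PreSpace Φ) : Φ.Pt (S.Fiber (S.preProj a)) := ⟨a.1, S.coords a.2.1⟩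

/-- The relation `⨆ᵢⱼ εᵢⱼ^M`. -/
def preEqv (a b : S.PreSpace Φ) : Prop :=
  ∃ h : S.preProj a = S.preProj b, S.append a.2.1 b.2.1 h ∈ S.interp (Φ.eqv a.1 b.1)

/-- The graph `⨆ᵢₖ θᵢₖ^M`. -/
def preGraph (Θ : DefFun Φ Ψ) (a : S.PreSpace Φ) (b : S.PreSpace Ψ) : Prop :=
  ∃ h : S.preProj a = S.preProj b, S.append a.2.1 b.2.1 h ∈ S.interp (Θ.graph a.1 b.1)

/-- The point of `⨆ᵢ φᵢ^M` given by a base point and a tuple in its fiber. -/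
def ofPt (x : X) (s : Φ.Pt (S.Fiber x)) (hs : Φ.Dom s) : S.PreSpace Φ :=
  ⟨s.1, S.tuple x s.2, hs⟩

variable {S}

theorem exists_ofPt (a : S.PreSpace Φ) : ∃ x s hs, S.ofPt x s hs = a :=
  ⟨S.preProj a, S.prePt a, a.2.2, rfl⟩

theorem append_tuple {m n : ℕ} {x : X} (a : Fin m → S.Fiber x) (b : Fin n → S.Fiber x) :
    S.append (S.tuple x a) (S.tuple x b) rfl = S.tuple x (Fin.append a b) := by
  refine Subtype.ext (Prod.ext rfl ?_)
  funext i
  refine Fin.addCases (fun i => ?_) (fun i => ?_) i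
  · simp only [append, tuple, Fin.append_left]
  · simp only [append, tuple, Fin.append_right]

theorem preEqv_ofPt {x : X} {s t : Φ.Pt (S.Fiber x)} {hs : Φ.Dom s} {ht : Φ.Dom t} :
    S.preEqv (S.ofPt x s hs) (S.ofPt x t ht) ↔ Φ.Eqv s t := by
  refine ⟨fun ⟨_, h⟩ => ?_, fun h => ⟨rfl, ?_⟩⟩
  · change S.append (S.tuple x s.2) (S.tuple x t.2) rfl ∈ _ at h
    rw [append_tuple] at h
    exact h
  · change S.append (S.tuple x s.2) (S.tuple x t.2) rfl ∈ _
    rw [append_tuple]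
    exact h

theorem preGraph_ofPt {Θ : DefFun Φ Ψ} {x : X} {s : Φ.Pt (S.Fiber x)} {t : Ψ.Pt (S.Fiber x)}
    {hs : Φ.Dom s} {ht : Ψ.Dom t} :
    S.preGraph Θ (S.ofPt x s hs) (S.ofPt x t ht) ↔ Θ.Graph s t := by
  refine ⟨fun ⟨_, h⟩ => ?_, fun h => ⟨rfl, ?_⟩⟩
  · change S.append (S.tuple x s.2) (S.tuple x t.2) rfl ∈ _ at h
    rw [append_tuple] at h
    exact h
  · change S.append (S.tuple x s.2) (S.tuple x t.2) rfl ∈ _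
    rw [append_tuple]
    exact h

theorem continuous_preProj : Continuous (S.preProj (Φ := Φ)) :=
  continuous_sigma fun _ => (S.continuous_base _).comp continuous_subtype_val

theorem isOpenMap_preProj : IsOpenMap (S.preProj (Φ := Φ)) := by
  rw [isOpenMap_sigma]
  intro i
  exact (S.isOpenMap_base _).comp (S.isOpen_interp (Φ.dom_sigma i)).isOpenMap_subtype_val

theorem isLocallyInjective_preProj : IsLocallyInjective (S.preProj (Φ := Φ)) := by
  rintro ⟨i, z⟩
  choose U hU hzU hinj using fun q => S.isLocalHomeomorph.isLocallyInjective (z.1.1.2 q)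
  refine ⟨Sigma.mk i '' {y | ∀ q, y.1.1.2 q ∈ U q}, isOpenMap_sigmaMk _ ?_, ⟨z, hzU, rfl⟩, ?_⟩
  · rw [Set.ofPred_forall]
    exact isOpen_iInter_of_finite fun q => (hU q).preimage
      ((S.continuous_coord _ q).comp continuous_subtype_val)
  · rintro _ ⟨y, hy, rfl⟩ _ ⟨y', hy', rfl⟩ h
    have h : y.1.1.1 = y'.1.1.1 := h
    congr 1
    refine Subtype.ext (Subtype.ext (Prod.ext h (funext fun q => hinj q (hy q) (hy' q) ?_)))
    rw [y.1.2 q, y'.1.2 q, h]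

theorem continuous_append (S : EtaleStructure L X M) (m n : ℕ) :
    Continuous fun c : {c : FiberPow S.proj m × FiberPow S.proj n // c.1.1.1 = c.2.1.1} =>
      S.append c.1.1 c.1.2 c.2 := by
  refine Continuous.subtype_mk (Continuous.prodMk ?_ (continuous_pi fun i => ?_)) _
  · exact (S.continuous_base m).comp (continuous_fst.comp continuous_subtype_val)
  · refine Fin.addCases (fun i => ?_) (fun i => ?_) i
    · simp only [Fin.append_left]
      exact (S.continuous_coord m i).comp (continuous_fst.comp continuous_subtype_val)
    · simp only [Fin.append_right]
      exact (S.continuous_coord n i).comp (continuous_snd.comp continuous_subtype_val)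

/-- Images of open sets under a family of `Σ₁` relations `⨆ᵢₖ θᵢₖ^M` are open. -/
theorem isOpen_rel_image (θ : ∀ i k, Formula L (Φ.ar i + Ψ.ar k)) (hθ : ∀ i k, (θ i k).IsSigma1)
    {V : Set (S.PreSpace Ψ)} (hV : IsOpen V) :
    IsOpen {a : S.PreSpace Φ | ∃ b ∈ V, ∃ h : S.preProj a = S.preProj b,
      S.append a.2.1 b.2.1 h ∈ S.interp (θ a.1 b.1)} := by
  rw [isOpen_sigma_iff]
  intro i
  have : ∀ k, IsOpen {a : S.interp (Φ.dom i) | ∃ b : S.interp (Ψ.dom k),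
      ∃ h : a.1.1.1 = b.1.1.1, (⟨(a, b), h⟩ : {c : S.interp (Φ.dom i) × S.interp (Ψ.dom k) //
        c.1.1.1.1 = c.2.1.1.1}) ∈ {c : {c : S.interp (Φ.dom i) × S.interp (Ψ.dom k) //
        c.1.1.1.1 = c.2.1.1.1} | S.append c.1.1.1 c.1.2.1 c.2 ∈ S.interp (θ i k) ∧
          (⟨k, c.1.2⟩ : S.PreSpace Ψ) ∈ V}} := by
    intro k
    refine isOpen_exists ((S.continuous_base _).comp continuous_subtype_val)
      ((S.isOpenMap_base _).comp (S.isOpen_interp (Ψ.dom_sigma k)).isOpenMap_subtype_val) ?_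
    refine IsOpen.inter ?_ ?_
    · refine (S.isOpen_interp (hθ i k)).preimage ((S.continuous_append _ _).comp
        (f := fun c : {c : S.interp (Φ.dom i) × S.interp (Ψ.dom k) //
          c.1.1.1.1 = c.2.1.1.1} => ⟨(c.1.1.1, c.1.2.1), c.2⟩) ?_)
      exact Continuous.subtype_mk
        ((continuous_subtype_val.comp (continuous_fst.comp continuous_subtype_val)).prodMk
          (continuous_subtype_val.comp (continuous_snd.comp continuous_subtype_val))) _
    · exact hV.preimage (continuous_sigmaMk.comp (continuous_snd.comp continuous_subtype_val))
  convert isOpen_iUnion this using 1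
  ext a
  simp only [Set.mem_preimage, Set.mem_ofPred_eq, Set.mem_iUnion]
  exact ⟨fun ⟨⟨k, b⟩, hb, h, hab⟩ => ⟨k, b, h, hab, hb⟩, fun ⟨k, b, h, hab, hb⟩ =>
    ⟨⟨k, b⟩, hb, h, hab⟩⟩

/-- The action on `⨆ᵢ φᵢ^M`. -/
def preAct (g : S.IsoGpd) (a : S.PreSpace Φ) (h : S.preProj a = g.dom) : S.PreSpace Φ :=
  ⟨a.1, S.actPow g a.2.1 h, (S.realize_actPow _ g a.2.1 h).2 a.2.2⟩

theorem preAct_ofPt {x y : X} (g : S.Fiber x ≃[L] S.Fiber y) (s : Φ.Pt (S.Fiber x))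
    (hs : Φ.Dom s) : preAct ⟨x, y, g⟩ (S.ofPt x s hs) rfl =
      S.ofPt y (s.map g) ((Imaginary.dom_map g s).2 hs) := rfl

theorem preAct_eqv {g : S.IsoGpd} {a b : S.PreSpace Φ} (h : S.preEqv a b)
    (ha : S.preProj a = g.dom) (hb : S.preProj b = g.dom) :
    S.preEqv (preAct g a ha) (preAct g b hb) := by
  obtain ⟨x, s, hs, rfl⟩ := exists_ofPt a
  obtain ⟨y, t, ht, rfl⟩ := exists_ofPt b
  obtain ⟨x', z, g⟩ := g
  obtain rfl : x = x' := ha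
  obtain rfl : y = x := hb
  rw [preAct_ofPt, preAct_ofPt, preEqv_ofPt]
  exact (Imaginary.eqv_map g s t).2 (preEqv_ofPt.1 h)

theorem preAct_graph {Θ : DefFun Φ Ψ} {g : S.IsoGpd} {a : S.PreSpace Φ} {b : S.PreSpace Ψ}
    (h : S.preGraph Θ a b) (ha : S.preProj a = g.dom) (hb : S.preProj b = g.dom) :
    S.preGraph Θ (preAct g a ha) (preAct g b hb) := by
  obtain ⟨x, s, hs, rfl⟩ := exists_ofPt a
  obtain ⟨y, t, ht, rfl⟩ := exists_ofPt b
  obtain ⟨x', z, g⟩ := g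
  obtain rfl : x = x' := ha
  obtain rfl : y = x := hb
  rw [preAct_ofPt, preAct_ofPt, preGraph_ofPt]
  exact (DefFun.graph_map g s t).2 (preGraph_ofPt.1 h)

theorem continuous_preAct :
    Continuous fun q : {q : S.IsoGpd × S.PreSpace Φ // S.preProj q.2 = q.1.dom} =>
      preAct q.1.1 q.1.2 q.2 := by
  rw [continuous_iff_continuousAt]
  rintro ⟨⟨g, ⟨i, z⟩⟩, h⟩
  let s : Set (S.IsoGpd × S.PreSpace Φ) := {q | S.preProj q.2 = q.1.dom}
  let f : S.IsoGpd × S.interp (Φ.dom i) → S.IsoGpd × S.PreSpace Φ := 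
    Prod.map _root_.id (Sigma.mk (β := fun i => S.interp (Φ.dom i)) i)
  have hf : IsOpenEmbedding f := IsOpenEmbedding.id.prodMap IsOpenEmbedding.sigmaMk
  have hf' := hf.restrictPreimage s
  refine (hf'.continuousAt_iff (x := ⟨(g, z), h⟩)).1 (Continuous.continuousAt ?_)
  have h0 : Continuous fun q : f ⁻¹' s => (⟨(q.1.1, q.1.2.1), q.2⟩ :
      {q : S.IsoGpd × FiberPow S.proj (Φ.ar i) // q.2.1.1 = q.1.dom}) :=
    Continuous.subtype_mk ((continuous_fst.comp continuous_subtype_val).prodMk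
      (continuous_subtype_val.comp (continuous_snd.comp continuous_subtype_val))) _
  have h1 := (S.continuous_actPow (Φ.ar i)).comp h0
  have h2 : Continuous fun q : f ⁻¹' s => (⟨S.actPow q.1.1 q.1.2.1 q.2,
      (S.realize_actPow _ _ _ q.2).2 q.1.2.2⟩ : S.interp (Φ.dom i)) := h1.subtype_mk _
  exact (continuous_sigmaMk (σ := fun i => S.interp (Φ.dom i))).comp h2

variable [SecondCountableTopology M]

/-- The equivalence relation `⨆ᵢⱼ εᵢⱼ^M` on `⨆ᵢ φᵢ^M`. -/
def preSetoid (hS : S.IsEtaleModel T) (Φ : Imaginary T) : Setoid (S.PreSpace Φ) where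
  r := S.preEqv
  iseqv :=
    { refl := fun a => by
        obtain ⟨x, s, hs, rfl⟩ := exists_ofPt a
        have := S.countable_fiber x
        exact preEqv_ofPt.2 (Imaginary.Eqv.refl (hS.isModel x) hs)
      symm := fun {a b} h => by
        obtain ⟨x, s, hs, rfl⟩ := exists_ofPt a
        obtain ⟨y, t, ht, rfl⟩ := exists_ofPt b
        obtain rfl : x = y := h.1
        have := S.countable_fiber x
        exact preEqv_ofPt.2 (Imaginary.Eqv.symm (hS.isModel x) (preEqv_ofPt.1 h))
      trans := fun {a b c} h h' => by
        obtain ⟨x, s, hs, rfl⟩ := exists_ofPt a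
        obtain ⟨y, t, ht, rfl⟩ := exists_ofPt b
        obtain ⟨z, r, hr, rfl⟩ := exists_ofPt c
        obtain rfl : x = y := h.1
        obtain rfl : x = z := h'.1
        have := S.countable_fiber x
        exact preEqv_ofPt.2
          (Imaginary.Eqv.trans (hS.isModel x) (preEqv_ofPt.1 h) (preEqv_ofPt.1 h')) }

/-- The total space of `Φ^M`. -/
abbrev Total (hS : S.IsEtaleModel T) (Φ : Imaginary T) : Type w := Quotient (S.preSetoid hS Φ)

theorem isOpenQuotientMap_mk (hS : S.IsEtaleModel T) (Φ : Imaginary T) :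
    IsOpenQuotientMap (Quotient.mk (S.preSetoid hS Φ)) where
  surjective := Quotient.mk_surjective
  continuous := continuous_quotient_mk'
  isOpenMap := by
    intro V hV
    rw [← isQuotientMap_quotient_mk'.isOpen_preimage]
    convert isOpen_rel_image (Φ := Φ) (Ψ := Φ) Φ.eqv Φ.eqv_sigma hV using 1
    ext a
    constructor
    · rintro ⟨b, hb, hab⟩
      exact ⟨b, hb, (S.preSetoid hS Φ).symm (Quotient.exact hab)⟩
    · rintro ⟨b, hb, hab⟩
      exact ⟨b, hb, (Quotient.sound (s := S.preSetoid hS Φ) hab).symm⟩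

/-- The projection `Φ^M → X`. -/
def totalProj (hS : S.IsEtaleModel T) (Φ : Imaginary T) : S.Total hS Φ → X :=
  Quotient.lift S.preProj fun _ _ h => h.1

theorem continuous_totalProj (hS : S.IsEtaleModel T) (Φ : Imaginary T) :
    Continuous (S.totalProj hS Φ) := continuous_preProj.quotient_lift _

theorem isLocalHomeomorph_totalProj (hS : S.IsEtaleModel T) (Φ : Imaginary T) :
    IsLocalHomeomorph (S.totalProj hS Φ) := by
  have hopen : IsOpenMap (S.totalProj hS Φ) :=
    (isOpenQuotientMap_mk hS Φ).isOpenMap_iff.2 isOpenMap_preProj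
  rw [isLocalHomeomorph_iff_isOpenEmbedding_restrict]
  intro a
  induction a using Quotient.inductionOn with | _ a
  obtain ⟨U, hU, haU, hinj⟩ := isLocallyInjective_preProj a
  have hV := (isOpenQuotientMap_mk hS Φ).isOpenMap U hU
  refine ⟨_, hV.mem_nhds ⟨a, haU, rfl⟩, Topology.IsOpenEmbedding.of_continuous_injective_isOpenMap
    ((continuous_totalProj hS Φ).comp continuous_subtype_val) ?_
    (hopen.comp hV.isOpenMap_subtype_val)⟩
  rintro ⟨_, b, hb, rfl⟩ ⟨_, c, hc, rfl⟩ hbc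
  obtain rfl : b = c := hinj hb hc hbc
  rfl

/-- The action on `Φ^M`. -/
def totalAct (hS : S.IsEtaleModel T) (Φ : Imaginary T) (g : S.IsoGpd) (a : S.Total hS Φ) :
    S.totalProj hS Φ a = g.dom → S.Total hS Φ :=
  Quotient.hrecOn (motive := fun a => S.totalProj hS Φ a = g.dom → S.Total hS Φ) a
    (fun a h => Quotient.mk (S.preSetoid hS Φ) (preAct g a h))
    (fun a b hab => Function.hfunext
      (congrArg (· = g.dom) (hab.1 : S.preProj a = S.preProj b))
      fun h h' _ => heq_of_eq (Quotient.sound (preAct_eqv hab h h')))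

theorem continuous_totalAct (hS : S.IsEtaleModel T) (Φ : Imaginary T) :
    Continuous fun q : {q : S.IsoGpd × S.Total hS Φ // S.totalProj hS Φ q.2 = q.1.dom} =>
      S.totalAct hS Φ q.1.1 q.1.2 q.2 := by
  let s : Set (S.IsoGpd × S.Total hS Φ) := {q | S.totalProj hS Φ q.2 = q.1.dom}
  let f : S.IsoGpd × S.PreSpace Φ → S.IsoGpd × S.Total hS Φ :=
    Prod.map _root_.id (Quotient.mk (S.preSetoid hS Φ))
  have hf : IsOpenQuotientMap f := IsOpenQuotientMap.id.prodMap (isOpenQuotientMap_mk hS Φ)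
  have hf' : IsOpenQuotientMap (s.restrictPreimage f) :=
    ⟨hf.surjective.restrictPreimage s, hf.continuous.restrictPreimage,
      hf.isOpenMap.restrictPreimage s⟩
  refine hf'.continuous_comp_iff.1 ?_
  exact (isOpenQuotientMap_mk hS Φ).continuous.comp (continuous_preAct (Φ := Φ))

/-- The étale `Iso_X(M)`-space `Φ^M = (⨆ᵢ φᵢ^M) / (⨆ᵢⱼ εᵢⱼ^M)`. -/
def imag (hS : S.IsEtaleModel T) (Φ : Imaginary T) : S.EtaleSpace where
  carrier := S.Total hS Φ
  proj := S.totalProj hS Φ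
  isLocalHomeomorph := S.isLocalHomeomorph_totalProj hS Φ
  act := S.totalAct hS Φ
  proj_act g a h := by
    induction a using Quotient.inductionOn with | _ a
    rfl
  act_id a := by
    induction a using Quotient.inductionOn with | _ a
    rfl
  act_comp f g a h := by
    induction a using Quotient.inductionOn with | _ a
    rfl
  continuous_act := S.continuous_totalAct hS Φ

end Interp

/-! #### The functor `Φ ↦ Φ^M` -/

section Functor

variable {T : Set (Formula L 0)} {Φ Ψ Ξ : Imaginary T} [SecondCountableTopology M]

theorem exists_preGraph (hS : S.IsEtaleModel T) (Θ : DefFun Φ Ψ) (a : S.PreSpace Φ) :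
    ∃ b, S.preGraph Θ a b := by
  obtain ⟨x, s, hs, rfl⟩ := exists_ofPt a
  have := S.countable_fiber x
  obtain ⟨t, ht⟩ := DefFun.Graph.total (hS.isModel x) Θ hs
  exact ⟨S.ofPt x t (ht.dom (hS.isModel x)).2, preGraph_ofPt.2 ht⟩

theorem preGraph_congr (hS : S.IsEtaleModel T) {Θ : DefFun Φ Ψ} {a a' : S.PreSpace Φ}
    {b b' : S.PreSpace Ψ} (h : S.preGraph Θ a b) (h' : S.preGraph Θ a' b') (ha : S.preEqv a a') :
    S.preEqv b b' := by
  obtain ⟨x, s, hs, rfl⟩ := exists_ofPt a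
  obtain ⟨y, s', hs', rfl⟩ := exists_ofPt a'
  obtain ⟨z, t, ht, rfl⟩ := exists_ofPt b
  obtain ⟨r, t', ht', rfl⟩ := exists_ofPt b'
  obtain rfl : x = y := ha.1
  obtain rfl : x = z := h.1
  obtain rfl : x = r := h'.1
  have := S.countable_fiber x
  exact preEqv_ofPt.2 (DefFun.Graph.congr (hS.isModel x) (preGraph_ofPt.1 h) (preGraph_ofPt.1 h')
    (preEqv_ofPt.1 ha))

theorem preGraph_inv (hS : S.IsEtaleModel T) {Θ : DefFun Φ Ψ} {a : S.PreSpace Φ}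
    {b b' : S.PreSpace Ψ} (h : S.preGraph Θ a b) (hb : S.preEqv b b') : S.preGraph Θ a b' := by
  obtain ⟨x, s, hs, rfl⟩ := exists_ofPt a
  obtain ⟨z, t, ht, rfl⟩ := exists_ofPt b
  obtain ⟨r, t', ht', rfl⟩ := exists_ofPt b'
  obtain rfl : x = z := h.1
  obtain rfl : x = r := hb.1
  have := S.countable_fiber x
  exact preGraph_ofPt.2 ((preGraph_ofPt.1 h).inv (hS.isModel x)
    (Imaginary.Eqv.refl (hS.isModel x) hs) (preEqv_ofPt.1 hb))

/-- The function `Θ^M : Φ^M → Ψ^M` with graph `⨆ᵢₖ θᵢₖ^M`. -/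
noncomputable def totalMap (hS : S.IsEtaleModel T) (Θ : DefFun Φ Ψ) :
    S.Total hS Φ → S.Total hS Ψ :=
  Quotient.lift (fun a => Quotient.mk (S.preSetoid hS Ψ) (exists_preGraph hS Θ a).choose)
    fun a a' h => Quotient.sound (s := S.preSetoid hS Ψ)
      (preGraph_congr hS (exists_preGraph hS Θ a).choose_spec
        (exists_preGraph hS Θ a').choose_spec h)

theorem totalMap_eq_iff (hS : S.IsEtaleModel T) (Θ : DefFun Φ Ψ) (a : S.PreSpace Φ)
    (b : S.PreSpace Ψ) : S.totalMap hS Θ (Quotient.mk (S.preSetoid hS Φ) a) =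
      Quotient.mk (S.preSetoid hS Ψ) b ↔ S.preGraph Θ a b := by
  have hc := (exists_preGraph hS Θ a).choose_spec
  refine ⟨fun h => preGraph_inv hS hc (Quotient.exact (s := S.preSetoid hS Ψ) h), fun h => ?_⟩
  exact Quotient.sound (s := S.preSetoid hS Ψ)
    (preGraph_congr hS hc h ((S.preSetoid hS Φ).refl a))

theorem continuous_totalMap (hS : S.IsEtaleModel T) (Θ : DefFun Φ Ψ) :
    Continuous (S.totalMap hS Θ) := by
  rw [(isOpenQuotientMap_mk hS Φ).isQuotientMap.continuous_iff]
  refine ⟨fun V hV => ?_⟩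
  convert isOpen_rel_image Θ.graph Θ.graph_sigma
    (hV.preimage (isOpenQuotientMap_mk hS Ψ).continuous) using 1
  ext a
  constructor
  · intro h
    obtain ⟨b, hb⟩ := exists_preGraph hS Θ a
    refine ⟨b, ?_, hb⟩
    rw [Set.mem_preimage, ← (totalMap_eq_iff hS Θ a b).2 hb]
    exact h
  · rintro ⟨b, hbV, hb⟩
    rw [Set.mem_preimage, Function.comp_apply, (totalMap_eq_iff hS Θ a b).2 hb]
    exact hbV

/-- The morphism `Θ^M : Φ^M → Ψ^M`. -/
noncomputable def imagMap (hS : S.IsEtaleModel T) (Θ : DefFun Φ Ψ) :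
    EtaleSpace.Hom (S.imag hS Φ) (S.imag hS Ψ) where
  toFun := S.totalMap hS Θ
  continuous_toFun := continuous_totalMap hS Θ
  proj_toFun a := by
    induction a using Quotient.inductionOn with | _ a
    exact ((exists_preGraph hS Θ a).choose_spec.1).symm
  map_act g a h := by
    induction a using Quotient.inductionOn with | _ a
    have hc := (exists_preGraph hS Θ a).choose_spec
    exact (totalMap_eq_iff hS Θ _ _).2 (preAct_graph hc h (hc.1.symm.trans h))

/-- The functor `Φ ↦ Φ^M` from `Σ₁` imaginaries over `T` to étale `Iso_X(M)`-spaces. -/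
noncomputable def imagFunctor (S : EtaleStructure L X M) (hS : S.IsEtaleModel T) :
    Imaginary T ⥤ S.EtaleSpace where
  obj Φ := S.imag hS Φ
  map {Φ Ψ} f := Quotient.lift (fun Θ : DefFun Φ Ψ => imagMap hS Θ) (fun Θ Θ' h => by
    apply EtaleSpace.Hom.ext
    funext a
    induction a using Quotient.inductionOn with | _ a
    obtain ⟨b, hb⟩ := exists_preGraph hS Θ a
    have hb' : S.preGraph Θ' a b := by
      obtain ⟨x, s, hs, rfl⟩ := exists_ofPt a
      obtain ⟨y, t, ht, rfl⟩ := exists_ofPt b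
      obtain rfl : x = y := hb.1
      have := S.countable_fiber x
      exact preGraph_ofPt.2 ((DefFun.equiv_graph h (hS.isModel x) s t).1 (preGraph_ofPt.1 hb))
    exact ((totalMap_eq_iff hS Θ a b).2 hb).trans ((totalMap_eq_iff hS Θ' a b).2 hb').symm) f
  map_id Φ := by
    apply EtaleSpace.Hom.ext
    funext a
    induction a using Quotient.inductionOn with | _ a
    exact (totalMap_eq_iff hS (DefFun.id Φ) a a).2 ((S.preSetoid hS Φ).refl a)
  map_comp {Φ Ψ Ξ} f g := by
    induction f using Quotient.inductionOn with | _ Θ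
    induction g using Quotient.inductionOn with | _ Θ'
    apply EtaleSpace.Hom.ext
    funext a
    induction a using Quotient.inductionOn with | _ a
    obtain ⟨b, hb⟩ := exists_preGraph hS Θ a
    obtain ⟨c, hc⟩ := exists_preGraph hS Θ' b
    have hac : S.preGraph (Θ.comp Θ') a c := by
      obtain ⟨x, s, hs, rfl⟩ := exists_ofPt a
      obtain ⟨y, t, ht, rfl⟩ := exists_ofPt b
      obtain ⟨z, r, hr, rfl⟩ := exists_ofPt c
      obtain rfl : x = y := hb.1
      obtain rfl : x = z := hc.1
      exact preGraph_ofPt.2 ((DefFun.graph_comp Θ Θ' s r).2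
        ⟨t, preGraph_ofPt.1 hb, preGraph_ofPt.1 hc⟩)
    refine ((totalMap_eq_iff hS (Θ.comp Θ') a c).2 hac).trans ?_
    change _ = S.totalMap hS Θ' (S.totalMap hS Θ (Quotient.mk (S.preSetoid hS Φ) a))
    rw [(totalMap_eq_iff hS Θ a b).2 hb, (totalMap_eq_iff hS Θ' b c).2 hc]

theorem secondCountable_imag [SecondCountableTopology X] (hS : S.IsEtaleModel T)
    (Φ : Imaginary T) : S.secondCountable ((imagFunctor S hS).obj Φ) := by
  have (i : Φ.ι) : SecondCountableTopology (S.interp (Φ.dom i)) :=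
    (IsEmbedding.subtypeVal.comp IsEmbedding.subtypeVal).isInducing.secondCountableTopology
  have : SecondCountableTopology (S.PreSpace Φ) := inferInstance
  exact (isOpenQuotientMap_mk hS Φ).isQuotientMap.secondCountableTopology
    (isOpenQuotientMap_mk hS Φ).isOpenMap

/-- The functor `Φ ↦ Φ^M` from `Σ₁` imaginaries over `T` to second-countable étale
`Iso_X(M)`-spaces, for second-countable `X`. -/
noncomputable def imagFunctorSC [SecondCountableTopology X] (S : EtaleStructure L X M)
    (hS : S.IsEtaleModel T) : Imaginary T ⥤ S.secondCountable.FullSubcategory :=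
  S.secondCountable.lift (imagFunctor S hS) (secondCountable_imag hS)

end Functor

end EtaleStructure
end Etale
end EtaleModels

/-! The engine of the proof is that, under `Σ₁` saturations, the isomorphism groupoid acts on each
M^n_X by an open map (`isOpen_actSet`). A basic neighbourhood N of g : M_x ≅ M_y imposes open
conditions on x and y and demands finitely many witnesses c with cᵢ ∈ Pᵢ and g(cᵢ) ∈ Qᵢ. So,
locally, N · U is found by adjoining such c to the tuples in U, saturating under the whole groupoid,
requiring the new coordinates to land in the Qᵢ, and projecting them away. The saturation is open
because `Σ₁` formulas define open sets, and the projection is open because M is étale.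

Let a be a point of an étale space A. Continuity of the action at (identity, a) yields an open set U
of finite tuples and a neighbourhood O of a such that every g carrying a tuple of U to a tuple of U
carries the point of O over the source to the point of O over the target (`exists_local_action`).
Hence g · u ↦ g · b, with b ∈ O over the base of u, is a well-defined equivariant map on the
saturation of U. It passes through a, is continuous since the action on tuples is open, and its
source is some φ^M (`SigmaMap.exists_mem_range`). Such maps have open image, so countably many of
them cover a second-countable A.

For two such maps c and d, the locus c = d in the fibre product of their sources is open because A
is étale, and invariant because c and d are equivariant; it is therefore `Σ₁`-definable
(`SigmaMap.exists_realize_iff`). The formulas for all pairs in a countable cover define an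
equivalence relation whose quotient is A. The same lemma, applied to the composite of f : Φ^M → Ψ^M
with the quotient map on a piece of Φ and to the quotient map on a piece of Ψ, makes the graph of f
definable, which gives fullness.

Semantic facts become provable ones because every countable model of `T` is isomorphic to a fibre:
whatever holds in all fibres is provable. This yields the axioms of the constructed imaginaries and
functions, and faithfulness. Second countability of X serves only to make every Φ^M
second-countable. -/

namespace EtaleModels

section Etale

variable {L : FirstOrder.Language.{u, v}} {X M : Type w} [TopologicalSpace X] [TopologicalSpace M]

namespace EtaleStructure

variable {S : EtaleStructure L X M}

/-! ### Saturations and the topology of the isomorphism groupoid -/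

variable (S) in
/-- The set `N · U` of all `g · a` with `g ∈ N` and `a ∈ U`. -/
def actSet {n : ℕ} (N : Set S.IsoGpd) (U : Set (FiberPow S.proj n)) : Set (FiberPow S.proj n) :=
  {z | ∃ (g : S.IsoGpd) (a : FiberPow S.proj n) (h : a.1.1 = g.dom),
    (g ∈ N ∧ a ∈ U) ∧ S.actPow g a h = z}

/-- As g is invertible, the point it moves to z must be g⁻¹z. In this form the codomain of g is
literally the base point of z, so no transport along an equality of base points remains. -/
theorem mem_actSet {n : ℕ} {N : Set S.IsoGpd} {U : Set (FiberPow S.proj n)}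
    {z : FiberPow S.proj n} : z ∈ S.actSet N U ↔ ∃ (x : X) (g : S.Fiber x ≃[L] S.Fiber z.1.1),
      ⟨x, z.1.1, g⟩ ∈ N ∧ S.tuple x (fun i => g.symm (S.coords z i)) ∈ U := by
  constructor
  · rintro ⟨⟨x, y, g⟩, ⟨⟨x', a⟩, ha⟩, h, ⟨hg, hU⟩, rfl⟩
    obtain rfl : x' = x := h
    refine ⟨x', g, hg, ?_⟩
    convert hU using 1
    refine Subtype.ext (Prod.ext rfl (funext fun i => ?_))
    exact congrArg Subtype.val (g.symm_apply_apply ⟨a i, ha i⟩)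
  · rintro ⟨x, g, hg, hU⟩
    refine ⟨_, _, rfl, ⟨hg, hU⟩, Subtype.ext (Prod.ext rfl (funext fun i => ?_))⟩
    exact congrArg Subtype.val (g.apply_symm_apply (S.coords z i))

theorem HasSigma1Saturations.exists_interp_eq_actSet (hsat : S.HasSigma1Saturations) {n : ℕ}
    {U : Set (FiberPow S.proj n)} (hU : IsOpen U) :
    ∃ φ : Formula L n, φ.IsSigma1 ∧ S.interp φ = S.actSet Set.univ U := by
  obtain ⟨φ, hφ, h⟩ := hsat n U hU
  exact ⟨φ, hφ, h.symm.trans (by simp [actSet])⟩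

/-- An open invariant subset of `M^n_X` is `Σ₁`-definable. -/
theorem HasSigma1Saturations.exists_interp_eq (hsat : S.HasSigma1Saturations) {n : ℕ}
    {U : Set (FiberPow S.proj n)} (hU : IsOpen U)
    (hinv : ∀ {x y : X} (g : S.Fiber x ≃[L] S.Fiber y) (a : Fin n → S.Fiber x),
      S.tuple x a ∈ U → S.tuple y (fun i => g (a i)) ∈ U) :
    ∃ φ : Formula L n, φ.IsSigma1 ∧ S.interp φ = U := by
  obtain ⟨φ, hφ, h⟩ := hsat.exists_interp_eq_actSet hU
  -- An invariant set is its own saturation.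
  refine ⟨φ, hφ, h.trans (Set.ext fun z => mem_actSet.trans ⟨?_, fun hz => ?_⟩)⟩
  · rintro ⟨x, g, -, hz⟩
    have := hinv g _ hz
    simp only [FirstOrder.Language.Equiv.apply_symm_apply] at this
    exact this
  · exact ⟨z.1.1, FirstOrder.Language.Equiv.refl L _, trivial, hz⟩

variable (S) in
/-- The set of all `g` with prescribed open conditions on the domain and the codomain that meet
`⟦Pᵢ ↦ Qᵢ⟧` for all `i`. -/
def basicSet {m : ℕ} (V W : Set X) (P Q : Fin m → Set M) : Set S.IsoGpd :=
  {g | g.dom ∈ V ∧ g.cod ∈ W ∧ ∀ i, g ∈ S.mapsSet (P i) (Q i)}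

/-- The sets `basicSet` include the generators of the topology (with m = 0 or m = 1) and are closed
under finite intersection by concatenating the families P and Q. They therefore form a basis. -/
theorem exists_basicSet_subset {N : Set S.IsoGpd} (hN : IsOpen N) {g : S.IsoGpd} (hg : g ∈ N) :
    ∃ (m : ℕ) (V W : Set X) (P Q : Fin m → Set M), IsOpen V ∧ IsOpen W ∧ (∀ i, IsOpen (P i)) ∧
      (∀ i, IsOpen (Q i)) ∧ g ∈ S.basicSet V W P Q ∧ S.basicSet V W P Q ⊆ N := by
  induction hN with
  | basic N hN =>
    rcases hN with (⟨V, hV, rfl⟩ | ⟨V, hV, rfl⟩) | ⟨P, Q, hP, hQ, rfl⟩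
    · exact ⟨0, V, Set.univ, Fin.elim0, Fin.elim0, hV, isOpen_univ, fun i => i.elim0,
        fun i => i.elim0, ⟨hg, trivial, fun i => i.elim0⟩, fun k hk => hk.1⟩
    · exact ⟨0, Set.univ, V, Fin.elim0, Fin.elim0, isOpen_univ, hV, fun i => i.elim0,
        fun i => i.elim0, ⟨trivial, hg, fun i => i.elim0⟩, fun k hk => hk.2.1⟩
    · exact ⟨1, Set.univ, Set.univ, fun _ => P, fun _ => Q, isOpen_univ, isOpen_univ,
        fun _ => hP, fun _ => hQ, ⟨trivial, trivial, fun _ => hg⟩, fun k hk => hk.2.2 0⟩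
  | univ =>
    exact ⟨0, Set.univ, Set.univ, Fin.elim0, Fin.elim0, isOpen_univ, isOpen_univ,
      fun i => i.elim0, fun i => i.elim0, ⟨trivial, trivial, fun i => i.elim0⟩,
      fun _ _ => trivial⟩
  | inter N N' _ _ ih ih' =>
    obtain ⟨m, V, W, P, Q, hV, hW, hP, hQ, h, hsub⟩ := ih hg.1
    obtain ⟨m', V', W', P', Q', hV', hW', hP', hQ', h', hsub'⟩ := ih' hg.2
    refine ⟨m + m', V ∩ V', W ∩ W', Fin.append P P', Fin.append Q Q', hV.inter hV',
      hW.inter hW', ?_, ?_, ⟨⟨h.1, h'.1⟩, ⟨h.2.1, h'.2.1⟩, ?_⟩, fun k hk => ⟨hsub ⟨hk.1.1,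
        hk.2.1.1, fun i => ?_⟩, hsub' ⟨hk.1.2, hk.2.1.2, fun i => ?_⟩⟩⟩
    · exact Fin.addCases (by simpa using hP) (by simpa using hP')
    · exact Fin.addCases (by simpa using hQ) (by simpa using hQ')
    · exact Fin.addCases (by simpa using h.2.2) (by simpa using h'.2.2)
    · simpa using hk.2.2 (Fin.castAdd m' i)
    · simpa using hk.2.2 (Fin.natAdd m i)
  | sUnion _ _ ih =>
    obtain ⟨N, hN, hgN⟩ := hg
    obtain ⟨m, V, W, P, Q, hV, hW, hP, hQ, h, hsub⟩ := ih N hN hgN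
    exact ⟨m, V, W, P, Q, hV, hW, hP, hQ, h, hsub.trans (Set.subset_sUnion_of_mem hN)⟩

variable (S) in
/-- The pullback `M^n_X → M^m_X` along a map of coordinates. -/
def reindex {m n : ℕ} (f : Fin m → Fin n) (z : FiberPow S.proj n) : FiberPow S.proj m :=
  ⟨(z.1.1, fun i => z.1.2 (f i)), fun i => z.2 (f i)⟩

variable (S) in
theorem continuous_reindex {m n : ℕ} (f : Fin m → Fin n) : Continuous (S.reindex f) :=
  Continuous.subtype_mk ((S.continuous_base n).prodMk
    (continuous_pi fun i => S.continuous_coord n (f i))) _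

theorem reindex_append_left {m n : ℕ} {x : X} (a : Fin m → S.Fiber x) (b : Fin n → S.Fiber x) :
    S.reindex (Fin.castAdd n) (S.tuple x (Fin.append a b)) = S.tuple x a := by
  simp [reindex, tuple]

theorem reindex_append_right {m n : ℕ} {x : X} (a : Fin m → S.Fiber x) (b : Fin n → S.Fiber x) :
    S.reindex (Fin.natAdd m) (S.tuple x (Fin.append a b)) = S.tuple x b := by
  simp [reindex, tuple]

variable (S) in
theorem isOpen_box {n : ℕ} {V : Set X} (hV : IsOpen V) {P : Fin n → Set M}
    (hP : ∀ i, IsOpen (P i)) : IsOpen {z : FiberPow S.proj n | z.1.1 ∈ V ∧ ∀ i, z.1.2 i ∈ P i} := by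
  have : IsOpen {z : FiberPow S.proj n | ∀ i, z.1.2 i ∈ P i} := by
    rw [Set.ofPred_forall]
    exact isOpen_iInter_of_finite fun i => (hP i).preimage (S.continuous_coord n i)
  exact (hV.preimage (S.continuous_base n)).inter this

/-- The action of the isomorphism groupoid on `M^n_X` is an open map. -/
theorem HasSigma1Saturations.isOpen_actSet (hsat : S.HasSigma1Saturations) {n : ℕ}
    {N : Set S.IsoGpd} (hN : IsOpen N) {U : Set (FiberPow S.proj n)} (hU : IsOpen U) :
    IsOpen (S.actSet N U) := by
  rw [isOpen_iff_forall_mem_open]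
  intro z hz
  obtain ⟨x, g, hg, hzU⟩ := mem_actSet.1 hz
  obtain ⟨m, V, W, P, Q, hV, hW, hP, hQ, ⟨hgV, hgW, hgPQ⟩, hsub⟩ := exists_basicSet_subset hN hg
  choose c hcP hcQ using hgPQ
  -- Tuples of U lengthened by m coordinates lying in the Pᵢ: the added coordinates are the
  -- witnesses for membership in ⟦Pᵢ ↦ Qᵢ⟧.
  let U' : Set (FiberPow S.proj (n + m)) := S.reindex (Fin.castAdd m) ⁻¹' U ∩
    S.reindex (Fin.natAdd n) ⁻¹' {z | z.1.1 ∈ V ∧ ∀ i, z.1.2 i ∈ P i}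
  have hU' : IsOpen U' := (hU.preimage (S.continuous_reindex _)).inter
    ((S.isOpen_box hV hP).preimage (S.continuous_reindex _))
  obtain ⟨φ, hφ, hφU⟩ := hsat.exists_interp_eq_actSet hU'
  -- Definability of the saturation is used only for its openness.
  have hsatU : IsOpen (S.actSet Set.univ U') := by
    rw [← hφU]
    exact S.isOpen_interp hφ
  refine ⟨_, ?_, isOpen_exists (A := FiberPow S.proj n) (B := FiberPow S.proj m)
    (S.continuous_base n) (S.isOpenMap_base m)
    (R := {c | S.append c.1.1 c.1.2 c.2 ∈ S.actSet Set.univ U' ∧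
      c.1.2.1.1 ∈ W ∧ ∀ i, c.1.2.1.2 i ∈ Q i})
    ((hsatU.preimage (S.continuous_append n m)).inter
      ((S.isOpen_box hW hQ).preimage (continuous_snd.comp continuous_subtype_val))), ?_⟩
  · rintro z' ⟨b, h, hsatz, hbW, hbQ⟩
    obtain ⟨x', k, -, hk, hkV, hkP⟩ := mem_actSet.1 hsatz
    -- If k carries (u, c) ∈ U' to (z', b) with b in the Qᵢ, then c witnesses that k is in the basic
    -- set, hence in N; the first n coordinates give z' = k · u.
    refine mem_actSet.2 ⟨x', k, hsub ⟨hkV, Set.mem_of_eq_of_mem h hbW, fun i => ?_⟩, ?_⟩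
    · refine ⟨_, hkP i, ?_⟩
      change (k (k.symm _)).1 ∈ _
      rw [k.apply_symm_apply]
      change Fin.append z'.1.2 b.1.2 (Fin.natAdd n i) ∈ Q i
      rw [Fin.append_right]
      exact hbQ i
    · have hcoords (i : Fin n) :
          S.coords (S.append z' b h) (Fin.castAdd m i) = S.coords z' i :=
        Subtype.ext (Fin.append_left z'.1.2 b.1.2 i)
      exact Set.mem_of_eq_of_mem (congrArg (S.tuple x')
        (funext fun i => congrArg (fun t : S.Fiber z'.1.1 => k.symm t) (hcoords i).symm)) hk
  -- For z itself the extra coordinates are the images under g of the witnesses c.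
  · refine ⟨S.tuple z.1.1 fun i => g (c i), rfl, ?_, hgW, hcQ⟩
    change S.append (S.tuple z.1.1 (S.coords z)) (S.tuple z.1.1 fun i => g (c i)) rfl ∈ _
    rw [append_tuple]
    refine mem_actSet.2 ⟨x, g, trivial, ?_⟩
    have : (fun i => g.symm (Fin.append (S.coords z) (fun i => g (c i)) i)) =
        Fin.append (fun i => g.symm (S.coords z i)) c := by
      funext i
      refine Fin.addCases (fun i => ?_) (fun i => ?_) i <;> simp
    change S.tuple x (fun i => g.symm (Fin.append (S.coords z) (fun i => g (c i)) i)) ∈ _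
    rw [this]
    refine ⟨?_, ?_⟩
    · rw [Set.mem_preimage, reindex_append_left]
      exact hzU
    · rw [Set.mem_preimage, reindex_append_right]
      exact ⟨hgV, hcP⟩

/-! ### Equivariant maps from `Σ₁`-definable sets to étale spaces -/

namespace EtaleSpace

variable {A B : S.EtaleSpace}

/-- A form of `act_comp` with the intermediate point as a variable, since rewriting that point
inside `act` is blocked by the proof argument depending on it. -/
theorem act_comp_of_eq {x y z : X} {f : S.Fiber x ≃[L] S.Fiber y} (g : S.Fiber y ≃[L] S.Fiber z)
    {a b : A.carrier} {h : A.proj a = x} (hab : A.act ⟨x, y, f⟩ a h = b) (hb : A.proj b = y) :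
    A.act ⟨x, z, g.comp f⟩ a h = A.act ⟨y, z, g⟩ b hb := by
  subst hab
  exact A.act_comp f g a h

/-- Each point of an étale space has a neighbourhood on which the action is determined by the
action on some finite tuple in `M`. -/
theorem exists_local_action (A : S.EtaleSpace) (a : A.carrier) :
    ∃ (n : ℕ) (U : Set (FiberPow S.proj n)) (O : Set A.carrier), IsOpen U ∧ IsOpen O ∧ a ∈ O ∧
      (∃ z ∈ U, z.1.1 = A.proj a) ∧ (∀ z ∈ U, ∃ b ∈ O, A.proj b = z.1.1) ∧
      ∀ {x y : X} (g : S.Fiber x ≃[L] S.Fiber y) (c : Fin n → S.Fiber x), S.tuple x c ∈ U →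
        S.tuple y (fun i => g (c i)) ∈ U → ∀ b ∈ O, ∀ b' ∈ O, ∀ h : A.proj b = x,
          A.proj b' = y → A.act ⟨x, y, g⟩ b h = b' := by
  obtain ⟨O₀, hO₀, haO₀, hinj⟩ := A.isLocalHomeomorph.isLocallyInjective a
  -- The action is defined only on a fibre product, so the preimage is extended to an open set E of
  -- the full product, where product neighbourhoods are available.
  obtain ⟨E, hE, hEO⟩ := hO₀.preimage A.continuous_act
  have haE : (⟨A.proj a, A.proj a, FirstOrder.Language.Equiv.refl L _⟩, a) ∈ E := by
    have : (⟨(⟨A.proj a, A.proj a, FirstOrder.Language.Equiv.refl L _⟩, a), rfl⟩ :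
        {q : S.IsoGpd × A.carrier // A.proj q.2 = q.1.dom}) ∈ Subtype.val ⁻¹' E := by
      rw [hEO, Set.mem_preimage, A.act_id]
      exact haO₀
    exact this
  obtain ⟨N, O₁, hN, hO₁, haN, haO₁, hNO⟩ := isOpen_prod_iff.1 hE _ _ haE
  obtain ⟨m, V, W, P, Q, hV, hW, hP, hQ, ⟨haV, haW, haPQ⟩, hsub⟩ := exists_basicSet_subset hN haN
  choose c hcP hcQ using haPQ
  have hO := hO₁.inter hO₀
  -- Both the source and the target tuple are to lie in the same set, so it carries the conditions
  -- for both ends of g: V and W on the base, Pᵢ and Qᵢ on the coordinates. The condition on the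
  -- image of `A.proj` supplies a point of O over each base.
  refine ⟨m, {z | z.1.1 ∈ (V ∩ W) ∩ A.proj '' (O₁ ∩ O₀) ∧ ∀ i, z.1.2 i ∈ P i ∩ Q i}, O₁ ∩ O₀,
    S.isOpen_box ((hV.inter hW).inter (A.isLocalHomeomorph.isOpenMap _ hO))
      fun i => (hP i).inter (hQ i), hO, ⟨haO₁, haO₀⟩,
    ⟨S.tuple (A.proj a) c, ⟨⟨⟨haV, haW⟩, a, ⟨haO₁, haO₀⟩, rfl⟩, fun i => ⟨hcP i, hcQ i⟩⟩, rfl⟩,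
    fun z hz => hz.1.2, ?_⟩
  intro x y g c hc hgc b hb b' hb' h h'
  -- The tuple c now plays the role of the witnesses. Thus g · b lies in O₀, where it agrees with b'
  -- because both lie over y.
  have hgN : (⟨x, y, g⟩ : S.IsoGpd) ∈ N :=
    hsub ⟨hc.1.1.1, hgc.1.1.2, fun i => ⟨c i, (hc.2 i).1, (hgc.2 i).2⟩⟩
  have : (⟨(⟨x, y, g⟩, b), h⟩ : {q : S.IsoGpd × A.carrier // A.proj q.2 = q.1.dom}) ∈
      Subtype.val ⁻¹' E := hNO ⟨hgN, hb.1⟩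
  rw [hEO] at this
  exact hinj this hb'.2 ((A.proj_act _ _ _).trans h'.symm)

/-- A continuous equivariant map over `X` from a definable set `φ^M` to an étale space. -/
structure SigmaMap (A : S.EtaleSpace) {n : ℕ} (φ : Formula L n) where
  /-- the underlying map -/
  toFun : S.interp φ → A.carrier
  continuous_toFun : Continuous toFun
  proj_toFun : ∀ z, A.proj (toFun z) = z.1.1.1
  map_act : ∀ g z (h : z.1.1.1 = g.dom), toFun ⟨S.actPow g z.1 h, (S.realize_actPow _ g _ h).2 z.2⟩ =
    A.act g (toFun z) ((proj_toFun z).trans h)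

/-- The map sends g · u to g · b, for u in the set U of `exists_local_action` and b ∈ O over the
base of u; its source, the saturation of U, is definable by hypothesis. -/
theorem SigmaMap.exists_mem_range (hsat : S.HasSigma1Saturations) (A : S.EtaleSpace)
    (a : A.carrier) : ∃ (n : ℕ) (φ : Formula L n) (_ : φ.IsSigma1) (c : A.SigmaMap φ),
      a ∈ Set.range c.toFun := by
  obtain ⟨n, U, O, hU, hO, haO, ⟨z₀, hz₀, hz₀a⟩, hUO, key⟩ := A.exists_local_action a
  obtain ⟨φ, hφ, hφU⟩ := hsat.exists_interp_eq_actSet hU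
  -- The graph of the desired map, to be shown total and single-valued on the saturation.
  let R (z : FiberPow S.proj n) (b : A.carrier) : Prop :=
    ∃ (x : X) (g : S.Fiber x ≃[L] S.Fiber z.1.1),
      S.tuple x (fun i => g.symm (S.coords z i)) ∈ U ∧ ∃ b₀ ∈ O, ∃ h : A.proj b₀ = x,
        A.act ⟨x, z.1.1, g⟩ b₀ h = b
  have hR (z : S.interp φ) : ∃ b, R z.1 b := by
    obtain ⟨x, g, -, hg⟩ := mem_actSet.1 (hφU.subset z.2)
    obtain ⟨b₀, hb₀, h⟩ := hUO _ hg
    exact ⟨_, x, g, hg, b₀, hb₀, h, rfl⟩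
  have hR_unique {z b b'} (h : R z b) (h' : R z b') : b = b' := by
    obtain ⟨x, g, hg, b₀, hb₀, hx, rfl⟩ := h
    obtain ⟨x', g', hg', b₀', hb₀', hx', rfl⟩ := h'
    -- The isomorphism g'⁻¹g carries one representative tuple in U to the other, hence b₀ to b₀';
    -- applying g' gives g · b₀ = g' · b₀'.
    have h0 := key (g'.symm.comp g) _ hg (by simpa using hg') b₀ hb₀ b₀' hb₀' hx hx'
    rw [← act_comp_of_eq g' h0 hx', ← FirstOrder.Language.Equiv.comp_assoc,
      FirstOrder.Language.Equiv.self_comp_symm, FirstOrder.Language.Equiv.refl_comp]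
  choose f hf using hR
  have hproj (z : S.interp φ) : A.proj (f z) = z.1.1.1 := by
    obtain ⟨x, g, hg, b₀, hb₀, hx, h⟩ := hf z
    rw [← h, A.proj_act]
  refine ⟨n, φ, hφ, ⟨f, ?_, hproj, ?_⟩, ⟨z₀, ?_⟩, ?_⟩
  · refine ⟨fun O' hO' => ?_⟩
    rw [isOpen_iff_forall_mem_open]
    intro z hz
    obtain ⟨x, g, hg, b₀, hb₀, hx, h⟩ := hf z
    obtain ⟨E, hE, hEO⟩ := hO'.preimage A.continuous_act
    have hbE : (⟨(⟨x, z.1.1.1, g⟩, b₀), hx⟩ :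
        {q : S.IsoGpd × A.carrier // A.proj q.2 = q.1.dom}) ∈ Subtype.val ⁻¹' E := by
      rw [hEO, Set.mem_preimage, h]
      exact hz
    obtain ⟨N, O₁, hN, hO₁, hgN, hbO₁, hNO⟩ := isOpen_prod_iff.1 hE _ _ hbE
    -- U is shrunk so that the point of O over the base can also be taken in O₁. By openness of the
    -- action, N applied to this set is then a neighbourhood of z.
    have hU₁ : IsOpen (U ∩ {y | y.1.1 ∈ A.proj '' (O ∩ O₁)}) := hU.inter
      ((A.isLocalHomeomorph.isOpenMap _ (hO.inter hO₁)).preimage (S.continuous_base n))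
    refine ⟨Subtype.val ⁻¹' S.actSet N (U ∩ {y | y.1.1 ∈ A.proj '' (O ∩ O₁)}), ?_,
      (hsat.isOpen_actSet hN hU₁).preimage continuous_subtype_val,
      mem_actSet.2 ⟨x, g, hgN, hg, b₀, ⟨hb₀, hbO₁⟩, hx⟩⟩
    intro z' hz'
    obtain ⟨x', g', hg'N, hg'U, b', ⟨hb', hb'₁⟩, hx'⟩ := mem_actSet.1 hz'
    have : (⟨(⟨x', z'.1.1.1, g'⟩, b'), hx'⟩ :
        {q : S.IsoGpd × A.carrier // A.proj q.2 = q.1.dom}) ∈ Subtype.val ⁻¹' E :=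
      hNO ⟨hg'N, hb'₁⟩
    rw [hEO] at this
    -- Single-valuedness replaces the representation chosen for z' by one inside N and O₁, where the
    -- action is known to land in O'.
    rw [Set.mem_preimage, hR_unique (hf z') ⟨x', g', hg'U, b', hb', hx', rfl⟩]
    exact this
  · rintro ⟨x, y, g⟩ ⟨⟨⟨x', c⟩, hc⟩, hz⟩ h
    obtain rfl : x' = x := h
    refine hR_unique (hf _) ?_
    obtain ⟨x₀, k, hk, b₀, hb₀, hx, h⟩ := hf ⟨⟨⟨x', c⟩, hc⟩, hz⟩
    refine ⟨x₀, g.comp k, ?_, b₀, hb₀, hx, ?_⟩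
    · have hcancel (i : Fin n) : (g.comp k).symm (g ⟨c i, hc i⟩) = k.symm ⟨c i, hc i⟩ := by
        rw [FirstOrder.Language.Equiv.comp_symm]
        exact congrArg k.symm (g.symm_apply_apply _)
      change S.tuple x₀ (fun i => (g.comp k).symm (g ⟨c i, hc i⟩)) ∈ U
      rw [funext hcancel]
      exact hk
    · exact act_comp_of_eq g h _
  · exact hφU.symm.subset (mem_actSet.2 ⟨_, FirstOrder.Language.Equiv.refl L _, trivial, hz₀⟩)
  -- The tuple z₀ ∈ U lies over the base of a, so the identity represents a as the value at z₀.
  · refine hR_unique (hf _) ⟨_, FirstOrder.Language.Equiv.refl L _, hz₀, a, haO, hz₀a.symm, ?_⟩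
    obtain ⟨⟨x, c⟩, hc⟩ := z₀
    obtain rfl : x = A.proj a := hz₀a
    exact A.act_id a

/-- The composite of an equivariant map on `φ^M` with a morphism of étale spaces. -/
def SigmaMap.comp {n : ℕ} {φ : Formula L n} (c : A.SigmaMap φ) (f : A.Hom B) : B.SigmaMap φ where
  toFun z := f.toFun (c.toFun z)
  continuous_toFun := f.continuous_toFun.comp c.continuous_toFun
  proj_toFun z := (f.proj_toFun _).trans (c.proj_toFun z)
  map_act g z h := by rw [c.map_act, f.map_act]

/-- Near a value, on a set O where the projection is injective, the range contains every point of O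
lying over the base image of the preimage of O. That base image is open because φ^M → X is an open
map. -/
theorem SigmaMap.isOpen_range {n : ℕ} {φ : Formula L n} (hφ : φ.IsSigma1) (c : A.SigmaMap φ) :
    IsOpen (Set.range c.toFun) := by
  rw [isOpen_iff_forall_mem_open]
  rintro _ ⟨z, rfl⟩
  obtain ⟨O, hO, hzO, hinj⟩ := A.isLocalHomeomorph.isLocallyInjective (c.toFun z)
  have hbase := (S.isOpenMap_base n).comp (S.isOpen_interp hφ).isOpenMap_subtype_val
  refine ⟨_, ?_, hO.inter ((hbase _ (hO.preimage c.continuous_toFun)).preimage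
    A.isLocalHomeomorph.continuous), hzO, z, hzO, (c.proj_toFun z).symm⟩
  rintro b ⟨hb, z', hz', hbz⟩
  exact ⟨z', hinj hz' hb ((c.proj_toFun z').trans hbz)⟩

/-- The relation `c(a) = d(b)` is `Σ₁`-definable for equivariant maps `c` and `d`. -/
theorem SigmaMap.exists_realize_iff (hsat : S.HasSigma1Saturations) {n m : ℕ} {φ : Formula L n}
    {ψ : Formula L m} (hφ : φ.IsSigma1) (hψ : ψ.IsSigma1) (c : A.SigmaMap φ) (d : A.SigmaMap ψ) :
    ∃ θ : Formula L (n + m), θ.IsSigma1 ∧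
      ∀ (x : X) (a : Fin n → S.Fiber x) (b : Fin m → S.Fiber x), θ.Realize (Fin.append a b) ↔
        ∃ (ha : S.tuple x a ∈ S.interp φ) (hb : S.tuple x b ∈ S.interp ψ),
          c.toFun ⟨_, ha⟩ = d.toFun ⟨_, hb⟩ := by
  -- The fibre product of φ^M and ψ^M over X, inside M^{n+m}_X.
  let D : Set (FiberPow S.proj (n + m)) :=
    S.reindex (Fin.castAdd m) ⁻¹' S.interp φ ∩ S.reindex (Fin.natAdd n) ⁻¹' S.interp ψ
  have hD : IsOpen D := ((S.isOpen_interp hφ).preimage (S.continuous_reindex _)).inter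
    ((S.isOpen_interp hψ).preimage (S.continuous_reindex _))
  -- Both maps lie over X and the projection of A is locally injective, so they agree on an open
  -- set.
  have hE : IsOpen {z : D | c.toFun ⟨_, z.2.1⟩ = d.toFun ⟨_, z.2.2⟩} := by
    refine A.isLocalHomeomorph.isLocallyInjective.isOpen_eqLocus
      (c.continuous_toFun.comp (Continuous.subtype_mk
        ((S.continuous_reindex _).comp continuous_subtype_val) _))
      (d.continuous_toFun.comp (Continuous.subtype_mk
        ((S.continuous_reindex _).comp continuous_subtype_val) _)) ?_
    funext z
    exact (c.proj_toFun _).trans (d.proj_toFun ⟨S.reindex (Fin.natAdd n) z.1, z.2.2⟩).symm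
  obtain ⟨θ, hθ, h⟩ := hsat.exists_interp_eq (hD.isOpenMap_subtype_val _ hE) (by
    rintro x y g a ⟨⟨_, hz⟩, hcd, rfl⟩
    refine ⟨⟨S.actPow ⟨x, y, g⟩ (S.tuple x a) rfl,
      (S.realize_actPow φ ⟨x, y, g⟩ (S.reindex _ (S.tuple x a)) rfl).2 hz.1,
      (S.realize_actPow ψ ⟨x, y, g⟩ (S.reindex _ (S.tuple x a)) rfl).2 hz.2⟩, ?_, rfl⟩
    refine (c.map_act ⟨x, y, g⟩ ⟨_, hz.1⟩ rfl).trans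
      (Eq.trans ?_ (d.map_act ⟨x, y, g⟩ ⟨_, hz.2⟩ rfl).symm)
    congr 1)
  refine ⟨θ, hθ, fun x a b => ?_⟩
  have ha := reindex_append_left a b
  have hb := reindex_append_right a b
  change S.tuple x (Fin.append a b) ∈ S.interp θ ↔ _
  rw [h]
  constructor
  · rintro ⟨⟨_, hz⟩, hcd, rfl⟩
    exact ⟨Set.mem_of_eq_of_mem ha.symm hz.1, Set.mem_of_eq_of_mem hb.symm hz.2,
      (congrArg c.toFun (Subtype.ext ha.symm)).trans
        (Eq.trans hcd (congrArg d.toFun (Subtype.ext hb)))⟩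
  · rintro ⟨h1, h2, hcd⟩
    exact ⟨⟨_, Set.mem_of_eq_of_mem (s := S.interp φ) ha h1,
      Set.mem_of_eq_of_mem (s := S.interp ψ) hb h2⟩,
      (congrArg c.toFun (Subtype.ext ha)).trans
        (hcd.trans (congrArg d.toFun (Subtype.ext hb.symm))), rfl⟩

/-- A continuous map over X between étale spaces is a local homeomorphism, so a bijective one is a
homeomorphism; equivariance of the inverse follows by injectivity. -/
theorem isIso_of_bijective (f : A ⟶ B) (hf : Function.Bijective (EtaleSpace.Hom.toFun f)) :
    IsIso f := by
  have hlocal : IsLocalHomeomorph f.toFun := by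
    refine IsLocalHomeomorph.of_comp (g := B.proj) ?_ B.isLocalHomeomorph f.continuous_toFun
    rw [show B.proj ∘ f.toFun = A.proj from funext f.proj_toFun]
    exact A.isLocalHomeomorph
  let e := hlocal.toHomeomorphOfBijective hf
  have he (a : A.carrier) : e.symm (f.toFun a) = a := e.symm_apply_apply a
  have he' (b : B.carrier) : f.toFun (e.symm b) = b := e.apply_symm_apply b
  have hproj (b : B.carrier) : A.proj (e.symm b) = B.proj b := by rw [← f.proj_toFun, he']
  refine ⟨⟨e.symm, e.symm.continuous, hproj, fun g b h => ?_⟩, ?_, ?_⟩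
  · apply hf.injective
    rw [he', f.map_act]
    congr 1
    exact (he' b).symm
  · exact EtaleSpace.Hom.ext (funext he)
  · exact EtaleSpace.Hom.ext (funext he')

end EtaleSpace
variable {T : Set (Formula L 0)}

/-! ### Imaginaries and definable functions from equivariant maps -/

/-- If `X` parametrizes the models of `T`, then `T` proves all sentences that hold in the fibers. -/
theorem Parametrizes.proves_alls (hpar : S.Parametrizes T) {n : ℕ} {φ : Formula L n}
    (h : ∀ (x : X) (a : Fin n → S.Fiber x), φ.Realize a) : Proves T φ.alls := by
  rw [EtaleModels.proves_alls]
  intro N _ _ hN a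
  obtain ⟨x, ⟨e⟩⟩ := (hpar N).1 hN
  exact (Formula.realize_equiv e φ a).1 (h x _)

variable [SecondCountableTopology M]

theorem mk_ofPt_eq_iff (hS : S.IsEtaleModel T) {Φ : Imaginary T} {x : X} {s t : Φ.Pt (S.Fiber x)}
    {hs : Φ.Dom s} {ht : Φ.Dom t} : Quotient.mk (S.preSetoid hS Φ) (S.ofPt x s hs) =
      Quotient.mk (S.preSetoid hS Φ) (S.ofPt x t ht) ↔ Φ.Eqv s t :=
  Quotient.eq.trans preEqv_ofPt

/-- A countable jointly surjective family of equivariant maps from `Σ₁`-definable sets presents an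
étale space as the interpretation of an imaginary. -/
theorem EtaleSpace.exists_iso_of_sigmaMaps (hsat : S.HasSigma1Saturations)
    (hpar : S.Parametrizes T) {A : S.EtaleSpace} {ι : Type} [Countable ι] (n : ι → ℕ)
    (φ : ∀ i, Formula L (n i)) (hφ : ∀ i, (φ i).IsSigma1) (c : ∀ i, A.SigmaMap (φ i))
    (hc : ∀ a, ∃ i, a ∈ Set.range (c i).toFun) :
    ∃ Φ : Imaginary T, Nonempty (S.imag hpar.isEtaleModel Φ ≅ A) := by
  choose ε hε hε_iff using fun i j => (c i).exists_realize_iff hsat (hφ i) (hφ j) (c j)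
  -- εᵢⱼ(a, b) says cᵢ(a) = cⱼ(b) in every fibre, so the equivalence axioms are those of equality in
  -- A.
  let Φ : Imaginary T :=
    { ι := ι
      ar := n
      dom := φ
      eqv := ε
      dom_sigma := hφ
      eqv_sigma := hε
      eqv_dom := fun i j => hpar.proves_alls fun x => forall_append.2 fun a b => by
        simp only [Formula.realize_imp, Formula.Realize, Formula.realize_relabel, Fin.append_left,
          Fin.append_right, hε_iff]
        rintro ⟨ha, hb, -⟩
        exact ⟨ha, hb⟩
      eqv_refl := fun i => hpar.proves_alls fun x a => by
        simp only [Formula.realize_imp, Formula.realize_relabel, append_comp, hε_iff]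
        exact fun ha => ⟨ha, ha, trivial⟩
      eqv_symm := fun i j => hpar.proves_alls fun x => forall_append.2 fun a b => by
        simp only [Formula.realize_imp, Formula.realize_relabel, append_comp, Fin.append_left,
          Fin.append_right, hε_iff]
        rintro ⟨ha, hb, h⟩
        exact ⟨hb, ha, h.symm⟩
      eqv_trans := fun i j k => hpar.proves_alls fun x => forall_append.2 fun z d => by
        revert z
        rw [forall_append]
        intro a b
        simp only [Formula.realize_imp, Formula.Realize, Formula.realize_relabel, append_comp,
          Fin.append_left, Fin.append_right, hε_iff]
        rintro ⟨⟨ha, hb, h⟩, ⟨hb', hd, h'⟩⟩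
        exact ⟨ha, hd, h.trans h'⟩ }
  let F₀ (a : S.PreSpace Φ) : A.carrier := (c a.1).toFun a.2
  have hF₀ (a b : S.PreSpace Φ) : S.preEqv a b ↔ F₀ a = F₀ b := by
    have hproj (a : S.PreSpace Φ) : A.proj (F₀ a) = S.preProj a := (c a.1).proj_toFun a.2
    -- Either side forces a common base point; once it is shared, both points can be written as
    -- tuples in one fibre.
    suffices S.preProj a = S.preProj b → (S.preEqv a b ↔ F₀ a = F₀ b) from
      ⟨fun h => (this h.1).1 h, fun h => (this (by rw [← hproj, ← hproj, h])).2 h⟩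
    intro hab
    obtain ⟨x, s, hs, rfl⟩ := exists_ofPt a
    obtain ⟨y, t, ht, rfl⟩ := exists_ofPt b
    obtain rfl : x = y := hab
    rw [preEqv_ofPt]
    exact (hε_iff s.1 t.1 x s.2 t.2).trans ⟨fun ⟨_, _, h⟩ => h, fun h => ⟨hs, ht, h⟩⟩
  let F : S.imag hpar.isEtaleModel Φ ⟶ A := EtaleSpace.Hom.mk
    (Quotient.lift F₀ fun a b h => (hF₀ a b).1 h)
    ((continuous_sigma fun i => (c i).continuous_toFun).quotient_lift _)
    (fun a => by
      induction a using Quotient.inductionOn with | _ a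
      exact (c a.1).proj_toFun a.2)
    (fun g a h => by
      induction a using Quotient.inductionOn with | _ a
      exact (c a.1).map_act g a.2 h)
  have : IsIso F := EtaleSpace.isIso_of_bijective F ⟨fun a b h => by
      induction a using Quotient.inductionOn with | _ a
      induction b using Quotient.inductionOn with | _ b
      exact Quotient.sound (s := S.preSetoid hpar.isEtaleModel Φ) ((hF₀ a b).2 h), fun a => by
      obtain ⟨i, z, hz⟩ := hc a
      exact ⟨Quotient.mk _ ⟨i, z⟩, hz⟩⟩
  exact ⟨Φ, ⟨asIso F⟩⟩

/-- Every second-countable étale space is the interpretation of an imaginary. -/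
theorem EtaleSpace.exists_iso_imag (hsat : S.HasSigma1Saturations) (hpar : S.Parametrizes T)
    (A : S.EtaleSpace) [SecondCountableTopology A.carrier] :
    ∃ Φ : Imaginary T, Nonempty (S.imag hpar.isEtaleModel Φ ≅ A) := by
  choose n φ hφ c hc using SigmaMap.exists_mem_range hsat A
  -- Lindelöf property: countably many of the open ranges, one through each point, already cover A.
  obtain ⟨t, ht, htU⟩ := TopologicalSpace.isOpen_iUnion_countable _
    fun a => (c a).isOpen_range (hφ a)
  have : Countable t := ht.to_subtype
  -- The index set of an imaginary lives in `Type`, so the countable set t is replaced by a small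
  -- copy.
  have : Countable (Shrink.{0} t) := (equivShrink.{0} t).symm.injective.countable
  let p (i : Shrink.{0} t) : A.carrier := ((equivShrink.{0} t).symm i).1
  refine exists_iso_of_sigmaMaps hsat hpar (fun i => n (p i)) (fun i => φ (p i))
    (fun i => hφ (p i)) (fun i => c (p i)) fun a => ?_
  obtain ⟨b, hb, hab⟩ := Set.mem_iUnion₂.1 (htU.symm.subset (Set.mem_iUnion.2 ⟨a, hc a⟩))
  refine ⟨equivShrink.{0} t ⟨b, hb⟩, ?_⟩
  have hp : p (equivShrink.{0} t ⟨b, hb⟩) = b :=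
    congrArg Subtype.val ((equivShrink.{0} t).symm_apply_apply ⟨b, hb⟩)
  rwa [hp]

/-! ### Fullness and faithfulness -/

/-- The map `φᵢ^M → Φ^M`. -/
def sigmaMapMk (hS : S.IsEtaleModel T) (Φ : Imaginary T) (i : Φ.ι) :
    (S.imag hS Φ).SigmaMap (Φ.dom i) where
  toFun z := Quotient.mk (S.preSetoid hS Φ) ⟨i, z⟩
  continuous_toFun := (isOpenQuotientMap_mk hS Φ).continuous.comp
    (continuous_sigmaMk (σ := fun i => S.interp (Φ.dom i)))
  proj_toFun _ := rfl
  map_act _ _ _ := rfl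

/-- Every morphism `Φ^M → Ψ^M` is induced by a `Σ₁`-definable function. -/
theorem exists_imagMap_eq (hsat : S.HasSigma1Saturations) (hpar : S.Parametrizes T)
    {Φ Ψ : Imaginary T}
    (f : EtaleSpace.Hom (S.imag hpar.isEtaleModel Φ) (S.imag hpar.isEtaleModel Ψ)) :
    ∃ Θ : DefFun Φ Ψ, imagMap hpar.isEtaleModel Θ = f := by
  have hS := hpar.isEtaleModel
  -- θᵢₖ defines the locus where f after the quotient map on φᵢ^M equals the quotient map on ψₖ^M.
  choose θ hθ hθ_iff using fun i k => ((sigmaMapMk hS Φ i).comp f).exists_realize_iff hsat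
    (Φ.dom_sigma i) (Ψ.dom_sigma k) (sigmaMapMk hS Ψ k)
  have hθ_iff' {x : X} (s : Φ.Pt (S.Fiber x)) (t : Ψ.Pt (S.Fiber x)) :
      (θ s.1 t.1).Realize (Fin.append s.2 t.2) ↔ ∃ (hs : Φ.Dom s) (ht : Ψ.Dom t),
        f.toFun (Quotient.mk _ (S.ofPt x s hs)) = Quotient.mk _ (S.ofPt x t ht) :=
    hθ_iff s.1 t.1 x s.2 t.2
  let Θ : DefFun Φ Ψ :=
    { graph := θ
      graph_sigma := hθ
      graph_dom := fun i k => hpar.proves_alls fun x => forall_append.2 fun a b => by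
        simp only [Formula.realize_imp, Formula.Realize, Formula.realize_relabel, Fin.append_left,
          Fin.append_right]
        intro h
        obtain ⟨ha, hb, -⟩ := (hθ_iff' ⟨i, a⟩ ⟨k, b⟩).1 h
        exact ⟨ha, hb⟩
      graph_inv := fun i j k l => hpar.proves_alls fun x => forall_append.2 fun z w => by
        revert z w
        rw [forall_append]; intro a a'
        rw [forall_append]; intro b b'
        simp only [Formula.realize_imp, Formula.Realize, Formula.realize_relabel, append_comp,
          Fin.append_left, Fin.append_right]
        rintro ⟨h, hs, ht⟩
        have := S.countable_fiber x
        obtain ⟨ha, hb, h⟩ := (hθ_iff' ⟨i, a⟩ ⟨k, b⟩).1 h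
        have ha' := (Imaginary.Eqv.dom (hS.isModel x) (s := ⟨i, a⟩) (t := ⟨j, a'⟩) hs).2
        have hb' := (Imaginary.Eqv.dom (hS.isModel x) (s := ⟨k, b⟩) (t := ⟨l, b'⟩) ht).2
        refine (hθ_iff' ⟨j, a'⟩ ⟨l, b'⟩).2 ⟨ha', hb', ?_⟩
        rw [← (mk_ofPt_eq_iff hS (hs := ha) (ht := ha')).2 hs, h]
        exact (mk_ofPt_eq_iff hS (hs := hb) (ht := hb')).2 ht
      total := fun i => hpar.proves_alls fun x a => by
        simp only [Formula.realize_imp, Formula.Realize, Formula.realize_exs]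
        intro ha
        obtain ⟨b, hb⟩ := Quotient.mk_surjective (f.toFun (Quotient.mk _ (S.ofPt x ⟨i, a⟩ ha)))
        obtain ⟨y, t, ht, rfl⟩ := exists_ofPt b
        -- Since f is a map over X, a representative of the value lies in the same fibre.
        obtain rfl : y = x := (congrArg (S.imag hS Ψ).proj hb).trans (f.proj_toFun _)
        exact ⟨t.1, t.2, (hθ_iff' ⟨i, a⟩ t).2 ⟨ha, ht, hb.symm⟩⟩
      unique := fun i k l => hpar.proves_alls fun x => forall_append.2 fun z b' => by
        revert z
        rw [forall_append]; intro a b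
        simp only [Formula.realize_imp, Formula.Realize, Formula.realize_relabel, append_comp,
          Fin.append_left, Fin.append_right]
        rintro ⟨h, h'⟩
        obtain ⟨ha, hb, h⟩ := (hθ_iff' ⟨i, a⟩ ⟨k, b⟩).1 h
        obtain ⟨ha', hb', h'⟩ := (hθ_iff' ⟨i, a⟩ ⟨l, b'⟩).1 h'
        exact (mk_ofPt_eq_iff hS (hs := hb) (ht := hb')).1 (h.symm.trans h') }
  refine ⟨Θ, EtaleSpace.Hom.ext (funext fun a => ?_)⟩
  induction a using Quotient.inductionOn with | _ a
  obtain ⟨b, hb⟩ := exists_preGraph hS Θ a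
  refine ((totalMap_eq_iff hS Θ a b).2 hb).trans ?_
  obtain ⟨x, s, hs, rfl⟩ := exists_ofPt a
  obtain ⟨y, t, ht, rfl⟩ := exists_ofPt b
  obtain rfl : x = y := hb.1
  obtain ⟨_, _, h⟩ := (hθ_iff' s t).1 (preGraph_ofPt.1 hb)
  exact h.symm

theorem full_imagFunctor (hsat : S.HasSigma1Saturations) (hpar : S.Parametrizes T) :
    (S.imagFunctor hpar.isEtaleModel).Full where
  map_surjective f := by
    obtain ⟨Θ, h⟩ := exists_imagMap_eq hsat hpar f
    exact ⟨Quotient.mk _ Θ, h⟩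

/-- The induced map determines the graph in every fibre, and equivalence of formulas in all fibres
is provable equivalence. -/
theorem faithful_imagFunctor (hpar : S.Parametrizes T) :
    (S.imagFunctor hpar.isEtaleModel).Faithful where
  map_injective {Φ Ψ} f g h := by
    induction f using Quotient.inductionOn with | _ Θ
    induction g using Quotient.inductionOn with | _ Θ'
    have hS := hpar.isEtaleModel
    have hmap : S.totalMap hS Θ = S.totalMap hS Θ' := congrArg EtaleSpace.Hom.toFun h
    refine Quotient.sound fun i k => hpar.proves_alls fun x => forall_append.2 fun a b => ?_
    have := S.countable_fiber x
    rw [Formula.realize_iff]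
    change Θ.Graph ⟨i, a⟩ ⟨k, b⟩ ↔ Θ'.Graph ⟨i, a⟩ ⟨k, b⟩
    -- Only pairs in the domains give points of the total spaces; elsewhere both graphs are false.
    by_cases hd : Φ.Dom (N := S.Fiber x) ⟨i, a⟩ ∧ Ψ.Dom (N := S.Fiber x) ⟨k, b⟩
    · rw [← preGraph_ofPt (hs := hd.1) (ht := hd.2), ← preGraph_ofPt (hs := hd.1) (ht := hd.2),
        ← totalMap_eq_iff hS, ← totalMap_eq_iff hS, hmap]
    · exact iff_of_false (fun h => hd (h.dom (hS.isModel x))) fun h => hd (h.dom (hS.isModel x))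

end EtaleStructure
end Etale
end EtaleModels

/-! ### The representation theorem and the equivalence of categories -/

theorem mainTheorem1 {L : FirstOrder.Language.{u, v}} [Countable L.Symbols]
    (T : Set (EtaleModels.Formula L 0)) (hT : T.Countable)
    {X M : Type w} [TopologicalSpace X] [TopologicalSpace M] [SecondCountableTopology M]
    (S : EtaleModels.EtaleStructure L X M) (hsat : S.HasSigma1Saturations)
    (hpar : S.Parametrizes T) :
    (∀ A : S.EtaleSpace, SecondCountableTopology A.carrier →
      ∃ Φ : EtaleModels.Imaginary T, Nonempty (S.imag hpar.isEtaleModel Φ ≅ A)) ∧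
    (∀ [SecondCountableTopology X], (S.imagFunctorSC hpar.isEtaleModel).IsEquivalence) := by
  refine ⟨fun A _ => A.exists_iso_imag hsat hpar, fun {_} => ?_⟩
  have := EtaleModels.EtaleStructure.full_imagFunctor hsat hpar
  have := EtaleModels.EtaleStructure.faithful_imagFunctor hpar
  have hfull : (S.imagFunctorSC hpar.isEtaleModel).Full :=
    inferInstanceAs (S.secondCountable.lift _ _).Full
  have hfaithful : (S.imagFunctorSC hpar.isEtaleModel).Faithful :=
    inferInstanceAs (S.secondCountable.lift _ _).Faithful
  have hsurj : (S.imagFunctorSC hpar.isEtaleModel).EssSurj := ⟨fun A => by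
    have : SecondCountableTopology A.obj.carrier := A.property
    obtain ⟨Φ, ⟨e⟩⟩ := A.obj.exists_iso_imag hsat hpar
    exact ⟨Φ, ⟨S.secondCountable.isoMk e⟩⟩⟩
  exact {}
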